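/- Consider the plant $\dot x = Ax+Bu+Ev$, $y=Cx$, $e=Cx+Fv$ with $x\in\mathbb R^n$, $u\in\mathbb R^m$, $y,e\in\mathbb R^p$, driven by the exosystem $\dot v=Sv$, $v\in\mathbb R^q$, all matrices real. Assume: (1) $(A,B)$ is stabilizable; (2) $(A,C)$ is observable; (3) $S$ has no eigenvalue with negative real part; (4) $\operatorname{rank}\begin{bmatrix}A-\lambda I_n & B\\ C& 0\end{bmatrix}=n+p$ for every eigenvalue $\lambda$ of $S$; (5) the minimal polynomial of $S$ is known. Let $\beta$ be a real square matrix whose characteristic polynomial is the minimal polynomial of $S$, let $\sigma$ be a real column such that $(\beta,\sigma)$ is controllable, and let $G_1=\operatorname{blockdiag}(\beta,\dots,\beta)$, $G_2=\operatorname{blockdiag}(\sigma,\dots,\sigma)$ ($p$ copies each). By (2) there is $L\in\mathbb R^{n\times p}$ such that $A-LC$ is Hurwitz. For any such $L$ write $\Lambda(s)=\det(sI_n-A+LC)=s^n+\alpha_{n-1}s^{n-1}+\cdots+\alpha_0$ and $(sI_n-A+LC)^{-1}=\Lambda(s)^{-1}\sum_{k=0}^{n-1}D_ks^k$. Let $\mathcal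 A$ be the $n\times n$ companion matrix with ones on the superdiagonal and last row $(-\alpha_0,\dots,-\alpha_{n-1})$, let $b=(0,\dots,0,1)^T\in\mathbb R^n$, and $$B_\zeta=\begin{bmatrix}I_m\otimes b\\0\end{bmatrix},\quad E_\zeta=\begin{bmatrix}0\\I_p\otimes b\end{bmatrix},\quad M=[M_1,\dots,M_{m+p}],\quad M_i=[D_0f_i,\dots,D_{n-1}f_i],$$ where $f_i$ is the $i$-th column of $[B,\ L]$. Put $$A_\zeta=I_{m+p}\otimes\mathcal A+E_\zeta CM,\qquad A_\rho=\begin{bmatrix}A_\zeta&0\\G_2CM&G_1\end{bmatrix},\qquad B_\rho=\begin{bmatrix}B_\zeta\\0\end{bmatrix}.$$ (i) The pair $(A_\rho,B_\rho)$ is stabilizable, for every $L$ such that $A-LC$ is Hurwitz. (ii) Let $K_\rho$ be any matrix such that $A_\rho+B_\rho K_\rho$ is Hurwitz, where $A-LC$ is Hurwitz. Then the dynamic output-feedback law $$u=K_\rho\rho,\quad \rho=\operatorname{col}(\zeta,z),\qquad \dot\zeta=(I_{m+p}\otimes\mathcal A)\zeta+B_\zeta u+E_\zeta y,\qquad \dot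 z=G_1z+G_2e$$ solves the output regulation problem: the closed-loop system with state $\operatorname{col}(x,\zeta,z)$ is exponentially stable when $v$ is set to zero, and $\lim_{t\to\infty}e(t)=0$ for all initial values of $x,\zeta,z,v$. The law is built from $\Lambda,\beta,\sigma,K_\rho$ only and does not otherwise use $A,B,C,E,F$: given these data, the same law works for every plant and exosystem that satisfy the assumptions above and admit an $L$ such that $A-LC$ is Hurwitz with characteristic polynomial $\Lambda$ and $A_\rho+B_\rho K_\rho$ is Hurwitz. -/

import Mathlib

open scoped Matrix Kronecker Polynomial

namespace OutputRegulation

noncomputable section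

/-! ### Notions from linear systems theory -/

/-- A real square matrix is Hurwitz if all its complex eigenvalues have negative real part. -/
def IsHurwitz {ι : Type} [Fintype ι] [DecidableEq ι] (A : Matrix ι ι ℝ) : Prop :=
  ∀ μ ∈ spectrum ℂ (A.map ((↑) : ℝ → ℂ)), μ.re < 0

/-- The pair `(A, B)` is stabilizable: some state feedback `u = K x` makes `A + B K` Hurwitz. -/
def IsStabilizable {ι κ : Type} [Fintype ι] [DecidableEq ι] [Fintype κ]
    (A : Matrix ι ι ℝ) (B : Matrix ι κ ℝ) : Prop :=
  ∃ K : Matrix κ ι ℝ, IsHurwitz (A + B * K)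

/-- The pair `(A, B)` is controllable: `[B, A B, …, A ^ (n - 1) B]` has rank `n`. -/
def IsControllable {n m : ℕ} (A : Matrix (Fin n) (Fin n) ℝ) (B : Matrix (Fin n) (Fin m) ℝ) :
    Prop :=
  (Matrix.of fun (i : Fin n) (kj : Fin n × Fin m) => (A ^ (kj.1 : ℕ) * B) i kj.2).rank = n

/-- The pair `(A, C)` is observable: `col (C, C A, …, C A ^ (n - 1))` has rank `n`. -/
def IsObservable {n p : ℕ} (A : Matrix (Fin n) (Fin n) ℝ) (C : Matrix (Fin p) (Fin n) ℝ) :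
    Prop :=
  (Matrix.of fun (ki : Fin n × Fin p) (j : Fin n) => (C * A ^ (ki.1 : ℕ)) ki.2 j).rank = n

/-! ### Plant, exosystem and output regulation -/

/-- The matrices of the plant `ẋ = A x + B u + E v`, `y = C x`, `e = C x + F v`
and of the exosystem `v̇ = S v`, where `x ∈ ℝⁿ`, `u ∈ ℝᵐ`, `y, e ∈ ℝᵖ`, `v ∈ ℝ^q`. -/
structure Plant (n m p q : ℕ) where
  A : Matrix (Fin n) (Fin n) ℝ
  B : Matrix (Fin n) (Fin m) ℝ
  C : Matrix (Fin p) (Fin n) ℝ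
  E : Matrix (Fin n) (Fin q) ℝ
  F : Matrix (Fin p) (Fin q) ℝ
  S : Matrix (Fin q) (Fin q) ℝ

/-- The standing assumptions on plant and exosystem. -/
structure Plant.StandingAssumptions {n m p q : ℕ} (P : Plant n m p q) : Prop where
  stabilizable : IsStabilizable P.A P.B
  observable : IsObservable P.A P.C
  /-- `S` has no eigenvalues with negative real part. -/
  exosystem : ∀ μ ∈ spectrum ℂ (P.S.map ((↑) : ℝ → ℂ)), 0 ≤ μ.re
  /-- No eigenvalue of `S` is a transmission zero. -/
  transmission : ∀ μ ∈ spectrum ℂ (P.S.map ((↑) : ℝ → ℂ)),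
    (Matrix.fromBlocks (P.A.map ((↑) : ℝ → ℂ) - μ • (1 : Matrix (Fin n) (Fin n) ℂ))
      (P.B.map ((↑) : ℝ → ℂ)) (P.C.map ((↑) : ℝ → ℂ))
      (0 : Matrix (Fin p) (Fin m) ℂ)).rank = n + p

/-- A linear dynamic output-feedback law with internal state `ξ ∈ ℝ^ι`, driven by the control
input `u`, the measurement output `y` and the regulated output `e`:
`u = K ξ`, `ξ̇ = N ξ + Nu u + Ny y + Ne e`. -/
structure OutputFeedbackLaw (m p : ℕ) (ι : Type) where
  K : Matrix (Fin m) ι ℝ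
  N : Matrix ι ι ℝ
  Nu : Matrix ι (Fin m) ℝ
  Ny : Matrix ι (Fin p) ℝ
  Ne : Matrix ι (Fin p) ℝ

/-- `(v, x, ξ)` is a trajectory on `[0, ∞)` of exosystem, plant and output-feedback law in
closed loop. -/
structure IsClosedLoopTrajectory {n m p q : ℕ} {ι : Type} [Fintype ι]
    (P : Plant n m p q) (Γ : OutputFeedbackLaw m p ι)
    (v : ℝ → Fin q → ℝ) (x : ℝ → Fin n → ℝ) (ξ : ℝ → ι → ℝ) : Prop where
  exosystem : ∀ t, 0 ≤ t → HasDerivWithinAt v (P.S *ᵥ v t) (Set.Ici 0) t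
  plant : ∀ t, 0 ≤ t →
    HasDerivWithinAt x (P.A *ᵥ x t + P.B *ᵥ (Γ.K *ᵥ ξ t) + P.E *ᵥ v t) (Set.Ici 0) t
  law : ∀ t, 0 ≤ t →
    HasDerivWithinAt ξ
      (Γ.N *ᵥ ξ t + Γ.Nu *ᵥ (Γ.K *ᵥ ξ t) + Γ.Ny *ᵥ (P.C *ᵥ x t)
        + Γ.Ne *ᵥ (P.C *ᵥ x t + P.F *ᵥ v t)) (Set.Ici 0) t

/-- The law `Γ` solves the output regulation problem for `P`: the closed loop is exponentially
stable when `v` is set to zero, and `e (t) = C x (t) + F v (t)` tends to `0` along every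
trajectory of the closed loop with the exosystem. -/
def SolvesOutputRegulation {n m p q : ℕ} {ι : Type} [Fintype ι]
    (P : Plant n m p q) (Γ : OutputFeedbackLaw m p ι) : Prop :=
  (∃ k > 0, ∃ c > 0, ∀ (x : ℝ → Fin n → ℝ) (ξ : ℝ → ι → ℝ),
    IsClosedLoopTrajectory P Γ 0 x ξ →
      ∀ t, 0 ≤ t → ‖(x t, ξ t)‖ ≤ k * Real.exp (-c * t) * ‖(x 0, ξ 0)‖) ∧
  ∀ (v : ℝ → Fin q → ℝ) (x : ℝ → Fin n → ℝ) (ξ : ℝ → ι → ℝ),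
    IsClosedLoopTrajectory P Γ v x ξ →
      Filter.Tendsto (fun t => P.C *ᵥ x t + P.F *ᵥ v t) Filter.atTop (nhds 0)

/-- The law `Γ` solves the output regulation problem without knowledge of the plant beyond its
membership in the class `Ps`: the same law works for every member of `Ps`. -/
def SolvesModelFreeOutputRegulation {n m p q : ℕ} {ι : Type} [Fintype ι]
    (Ps : Set (Plant n m p q)) (Γ : OutputFeedbackLaw m p ι) : Prop :=
  ∀ P ∈ Ps, SolvesOutputRegulation P Γ

/-! ### The internal model -/

/-- `(β, σ)` generates a minimal internal model of `S`: the characteristic polynomial of `β` is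
the minimal polynomial of `S`, and `(β, σ)` is controllable. -/
def IsMinimalInternalModel {q r : ℕ} (S : Matrix (Fin q) (Fin q) ℝ)
    (β : Matrix (Fin r) (Fin r) ℝ) (σ : Matrix (Fin r) (Fin 1) ℝ) : Prop :=
  β.charpoly = minpoly ℝ S ∧ IsControllable β σ

/-- `G₁ = blockdiag (β, …, β)`, `p` copies. -/
def G₁ (p : ℕ) {r : ℕ} (β : Matrix (Fin r) (Fin r) ℝ) :
    Matrix (Fin p × Fin r) (Fin p × Fin r) ℝ :=
  (1 : Matrix (Fin p) (Fin p) ℝ) ⊗ₖ β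

/-- `G₂ = blockdiag (σ, …, σ)`, `p` copies. -/
def G₂ (p : ℕ) {r : ℕ} (σ : Matrix (Fin r) (Fin 1) ℝ) : Matrix (Fin p × Fin r) (Fin p) ℝ :=
  Matrix.of fun ik j => if ik.1 = j then σ ik.2 0 else 0

/-! ### The filter `ζ` -/

/-- The companion matrix `𝒜` of `Λ = sⁿ + α_{n-1} sⁿ⁻¹ + ⋯ + α₀`: ones on the superdiagonal and
last row `(-α₀, …, -α_{n-1})`. -/
def companion (n : ℕ) (Λ : ℝ[X]) : Matrix (Fin n) (Fin n) ℝ :=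
  Matrix.of fun i j =>
    if (i : ℕ) + 1 = (j : ℕ) then 1 else if (i : ℕ) + 1 = n then -Λ.coeff (j : ℕ) else 0

/-- The vector `b = col (0, …, 0, 1)`. -/
def lastVec (n : ℕ) : Fin n → ℝ := fun i => if (i : ℕ) + 1 = n then 1 else 0

/-- `I_{m+p} ⊗ 𝒜`, acting on `ζ = col (ζ¹, …, ζ^{m+p})`. -/
def filterMatrix (n m p : ℕ) (Λ : ℝ[X]) :
    Matrix ((Fin m ⊕ Fin p) × Fin n) ((Fin m ⊕ Fin p) × Fin n) ℝ :=
  (1 : Matrix (Fin m ⊕ Fin p) (Fin m ⊕ Fin p) ℝ) ⊗ₖ companion n Λ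

/-- `B_ζ = col (I_m ⊗ b, 0)`. -/
def Bζ (n m p : ℕ) : Matrix ((Fin m ⊕ Fin p) × Fin n) (Fin m) ℝ :=
  Matrix.of fun ik j => if ik.1 = Sum.inl j then lastVec n ik.2 else 0

/-- `E_ζ = col (0, I_p ⊗ b)`. -/
def Eζ (n m p : ℕ) : Matrix ((Fin m ⊕ Fin p) × Fin n) (Fin p) ℝ :=
  Matrix.of fun ik j => if ik.1 = Sum.inr j then lastVec n ik.2 else 0

/-- The index type of `ρ = col (ζ, z)`. -/
abbrev RhoIndex (n m p r : ℕ) : Type := ((Fin m ⊕ Fin p) × Fin n) ⊕ (Fin p × Fin r)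

/-- The output-feedback law
`u = K_ρ ρ`, `ζ̇ = (I ⊗ 𝒜) ζ + B_ζ u + E_ζ y`, `ż = G₁ z + G₂ e`, with `ρ = col (ζ, z)`.
It is built from the known data `Λ`, `β`, `σ` and the gain `K_ρ` only. -/
def regulator {n m p r : ℕ} (Λ : ℝ[X]) (β : Matrix (Fin r) (Fin r) ℝ)
    (σ : Matrix (Fin r) (Fin 1) ℝ) (Kρ : Matrix (Fin m) (RhoIndex n m p r) ℝ) :
    OutputFeedbackLaw m p (RhoIndex n m p r) where
  K := Kρ
  N := Matrix.fromBlocks (filterMatrix n m p Λ) 0 0 (G₁ p β)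
  Nu := Matrix.fromRows (Bζ n m p) 0
  Ny := Matrix.fromRows (Eζ n m p) 0
  Ne := Matrix.fromRows 0 (G₂ p σ)

/-! ### The augmented auxiliary system -/

/-- The matrices `D_k` with `adj (s I - H) = ∑ D_k s ^ k`, so that
`(s I - H)⁻¹ = (D_{n-1} sⁿ⁻¹ + ⋯ + D₀) / det (s I - H)`. -/
def resolventCoeff {n : ℕ} (H : Matrix (Fin n) (Fin n) ℝ) (k : ℕ) : Matrix (Fin n) (Fin n) ℝ :=
  Matrix.of fun i j => (H.charmatrix.adjugate i j).coeff k

/-- `M = [M_1, …, M_{m+p}]` with `M_i = [D_0 f_i, …, D_{n-1} f_i]`, where `f_i` is the `i`-th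
column of `[B, L]` and the `D_k` belong to `H = A - L C`. -/
def Plant.M {n m p q : ℕ} (P : Plant n m p q) (L : Matrix (Fin n) (Fin p) ℝ) :
    Matrix (Fin n) ((Fin m ⊕ Fin p) × Fin n) ℝ :=
  Matrix.of fun a ik =>
    (resolventCoeff (P.A - L * P.C) (ik.2 : ℕ) * Matrix.fromCols P.B L) a ik.1

/-- `A_ζ = I_{m+p} ⊗ 𝒜 + E_ζ C M`, with `𝒜` the companion matrix of `det (s I - A + L C)`. -/
def Plant.Aζ {n m p q : ℕ} (P : Plant n m p q) (L : Matrix (Fin n) (Fin p) ℝ) :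
    Matrix ((Fin m ⊕ Fin p) × Fin n) ((Fin m ⊕ Fin p) × Fin n) ℝ :=
  filterMatrix n m p (P.A - L * P.C).charpoly + Eζ n m p * P.C * P.M L

/-- `A_ρ = [A_ζ, 0; G₂ C M, G₁]`. -/
def Plant.Aρ {n m p q r : ℕ} (P : Plant n m p q) (L : Matrix (Fin n) (Fin p) ℝ)
    (β : Matrix (Fin r) (Fin r) ℝ) (σ : Matrix (Fin r) (Fin 1) ℝ) :
    Matrix (RhoIndex n m p r) (RhoIndex n m p r) ℝ :=
  Matrix.fromBlocks (P.Aζ L) 0 (G₂ p σ * P.C * P.M L) (G₁ p β)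

/-- `B_ρ = col (B_ζ, 0)`; it does not depend on the plant matrices. -/
def Bρ (n m p r : ℕ) : Matrix (RhoIndex n m p r) (Fin m) ℝ :=
  Matrix.fromRows (Bζ n m p) 0

end

end OutputRegulation

open OutputRegulation

/-! Write `H = A - L C`. Comparing coefficients in `(s - H) ∑ D_k s ^ k = Λ(s)` gives `M (I ⊗ 𝒜) = H
M`, `M B_ζ = B` and `M E_ζ = L`. Hence `x - M ζ` obeys `ε̇ = H ε + E v`, and in the coordinates `(x
- M ζ, ρ)` the closed loop is block triangular with diagonal blocks `H` and `A_ρ + B_ρ K_ρ`; so it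
is Hurwitz. No rank condition on `M` is needed.

Regulation. The spectra of the closed loop `A_cl` and of `S` are disjoint, so `X S = A_cl X + R` has
a solution, and the state minus `X v` decays. The rows of the i-th internal model copy read `Z S = β
Z + σ φ`, where `φ` is the i-th row of `C X_x + F`; controllability of `(β, σ)` and the minimal
polynomial of `S` force `φ = 0` (`IsMinimalInternalModel.eq_zero`). Thus `e` tends to zero.

Stabilizability of `(A_ρ, B_ρ)`. Let a left eigenvector `(w, η)` with `Re μ ≥ 0` be killed by `B_ρ`.
Since `μ` is no eigenvalue of `H`, `w = h M` for some `h`, with `h B = 0` and `h A + η G₂ C = μ h`.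
If `μ` is an eigenvalue of `S`, the rank condition and controllability of `(β, σ)` give `h = 0` and
`η = 0`. Otherwise `μ` is no eigenvalue of `β`, so `η = 0`, and stabilizability of `(A, B)` gives `h
= 0`.

That this Hautus condition suffices is shown by convex duality: if `A P + B Y < 0` has no solution
with `P > 0`, Hahn-Banach yields a `Z ≠ 0` whose range contains a forbidden left eigenvector. With
no inputs the same inequality is Lyapunov's, which gives exponential decay. -/

namespace OutputRegulation

noncomputable section

section Complexification

variable {ι κ τ : Type}

/-! ### Complexification -/

/-- The complexification of a real matrix. -/
abbrev toC {ι κ : Type} (A : Matrix ι κ ℝ) : Matrix ι κ ℂ := A.map ((↑) : ℝ → ℂ)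

theorem toC_mul [Fintype κ] (A : Matrix ι κ ℝ) (B : Matrix κ τ ℝ) : toC (A * B) = toC A * toC B :=
  Matrix.map_mul (f := Complex.ofRealHom)

theorem toC_add (A B : Matrix ι κ ℝ) : toC (A + B) = toC A + toC B := by
  ext; simp

theorem toC_sub (A B : Matrix ι κ ℝ) : toC (A - B) = toC A - toC B := by
  ext; simp

theorem toC_transpose (A : Matrix ι κ ℝ) : (toC A)ᵀ = toC Aᵀ := rfl

theorem toC_injective : Function.Injective (toC : Matrix ι κ ℝ → Matrix ι κ ℂ) :=
  Matrix.map_injective Complex.ofReal_injective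

theorem re_toC_mulVec [Fintype κ] (A : Matrix ι κ ℝ) (x : κ → ℂ) (i : ι) :
    ((toC A *ᵥ x) i).re = (A *ᵥ fun j => (x j).re) i := by
  simp [Matrix.mulVec, dotProduct]

theorem im_toC_mulVec [Fintype κ] (A : Matrix ι κ ℝ) (x : κ → ℂ) (i : ι) :
    ((toC A *ᵥ x) i).im = (A *ᵥ fun j => (x j).im) i := by
  simp [Matrix.mulVec, dotProduct]

theorem toC_mulVec_eq_zero_iff [Fintype κ] (A : Matrix ι κ ℝ) (x : κ → ℂ) :
    toC A *ᵥ x = 0 ↔ (A *ᵥ fun j => (x j).re) = 0 ∧ (A *ᵥ fun j => (x j).im) = 0 := by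
  simp only [funext_iff, Complex.ext_iff, re_toC_mulVec, im_toC_mulVec, Pi.zero_apply,
    Complex.zero_re, Complex.zero_im, forall_and]

/-- Injectivity of a real matrix is inherited by its complexification. -/
theorem toC_mulVec_injective [Fintype κ] {A : Matrix ι κ ℝ} (h : ∀ x, A *ᵥ x = 0 → x = 0)
    (x : κ → ℂ) (hx : toC A *ᵥ x = 0) : x = 0 := by
  rw [toC_mulVec_eq_zero_iff] at hx
  funext j
  exact Complex.ext (congrFun (h _ hx.1) j) (congrFun (h _ hx.2) j)

end Complexification

/-! ### Spectra -/

section Spectra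

variable {ι κ : Type} [Fintype ι] [DecidableEq ι] [Fintype κ]

theorem mem_spectrum_iff_mulVec (A : Matrix ι ι ℂ) (μ : ℂ) :
    μ ∈ spectrum ℂ A ↔ ∃ x ≠ 0, A *ᵥ x = μ • x := by
  rw [spectrum.mem_iff, Matrix.isUnit_iff_isUnit_det, isUnit_iff_ne_zero, not_not,
    ← Matrix.exists_mulVec_eq_zero_iff]
  refine exists_congr fun x => and_congr_right fun _ => ?_
  rw [Algebra.algebraMap_eq_smul_one, Matrix.sub_mulVec, Matrix.smul_mulVec, Matrix.one_mulVec,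
    sub_eq_zero, eq_comm]

theorem mem_spectrum_iff_vecMul (A : Matrix ι ι ℂ) (μ : ℂ) :
    μ ∈ spectrum ℂ A ↔ ∃ x ≠ 0, x ᵥ* A = μ • x := by
  rw [spectrum.mem_iff, Matrix.isUnit_iff_isUnit_det, isUnit_iff_ne_zero, not_not,
    ← Matrix.exists_vecMul_eq_zero_iff]
  refine exists_congr fun x => and_congr_right fun _ => ?_
  rw [Algebra.algebraMap_eq_smul_one, Matrix.vecMul_sub, Matrix.vecMul_smul, Matrix.vecMul_one,
    sub_eq_zero, eq_comm]

theorem mem_spectrum_iff_aeval_charpoly (A : Matrix ι ι ℝ) (μ : ℂ) :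
    μ ∈ spectrum ℂ (toC A) ↔ Polynomial.aeval μ A.charpoly = 0 := by
  rw [Matrix.mem_spectrum_iff_isRoot_charpoly, Polynomial.IsRoot.def, Polynomial.aeval_def,
    Polynomial.eval₂_eq_eval_map]
  have : (toC A).charpoly = A.charpoly.map (algebraMap ℝ ℂ) :=
    Matrix.charpoly_map A (algebraMap ℝ ℂ)
  rw [this]

theorem mem_spectrum_of_aeval_minpoly {A : Matrix ι ι ℝ} {μ : ℂ}
    (h : Polynomial.aeval μ (minpoly ℝ A) = 0) : μ ∈ spectrum ℂ (toC A) := by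
  rw [mem_spectrum_iff_aeval_charpoly]
  obtain ⟨c, hc⟩ := Matrix.minpoly_dvd_charpoly A
  rw [hc, map_mul, h, zero_mul]

theorem isHurwitz_iff_mulVec (A : Matrix ι ι ℝ) :
    IsHurwitz A ↔ ∀ μ : ℂ, 0 ≤ μ.re → ∀ x, toC A *ᵥ x = μ • x → x = 0 := by
  refine ⟨fun h μ hμ x hx => ?_, fun h μ hμ => ?_⟩
  · by_contra hne
    exact (h μ ((mem_spectrum_iff_mulVec _ _).2 ⟨x, hne, hx⟩)).not_ge hμ
  · obtain ⟨x, hne, hx⟩ := (mem_spectrum_iff_mulVec _ _).1 hμ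
    by_contra hμ
    exact hne (h μ (not_lt.1 hμ) x hx)

theorem isHurwitz_iff_vecMul (A : Matrix ι ι ℝ) :
    IsHurwitz A ↔ ∀ μ : ℂ, 0 ≤ μ.re → ∀ x, x ᵥ* toC A = μ • x → x = 0 := by
  refine ⟨fun h μ hμ x hx => ?_, fun h μ hμ => ?_⟩
  · by_contra hne
    exact (h μ ((mem_spectrum_iff_vecMul _ _).2 ⟨x, hne, hx⟩)).not_ge hμ
  · obtain ⟨x, hne, hx⟩ := (mem_spectrum_iff_vecMul _ _).1 hμ
    by_contra hμ
    exact hne (h μ (not_lt.1 hμ) x hx)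

theorem IsHurwitz.transpose {A : Matrix ι ι ℝ} (h : IsHurwitz A) : IsHurwitz Aᵀ := by
  rw [isHurwitz_iff_vecMul] at h
  rw [isHurwitz_iff_mulVec]
  intro μ hμ x hx
  exact h μ hμ x (by rw [← hx, ← toC_transpose, Matrix.mulVec_transpose])

/-- The Hurwitz property is reflected along an injective intertwiner. -/
theorem IsHurwitz.of_intertwining [DecidableEq κ] {A : Matrix ι ι ℝ} {A' : Matrix κ κ ℝ}
    (h : IsHurwitz A') (J : Matrix κ ι ℝ) (J' : Matrix ι κ ℝ) (hJ : J' * J = 1)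
    (hJA : J * A = A' * J) : IsHurwitz A := by
  rw [isHurwitz_iff_mulVec] at h ⊢
  intro μ hμ x hx
  have h1 : toC J *ᵥ x = 0 := by
    apply h μ hμ
    rw [Matrix.mulVec_mulVec, ← toC_mul, ← hJA, toC_mul, ← Matrix.mulVec_mulVec, hx,
      Matrix.mulVec_smul]
  have h2 : toC J' *ᵥ (toC J *ᵥ x) = x := by
    rw [Matrix.mulVec_mulVec, ← toC_mul, hJ]
    simp [toC]
  rw [← h2, h1, Matrix.mulVec_zero]

/-- A block triangular matrix with Hurwitz diagonal blocks is Hurwitz. -/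
theorem IsHurwitz.fromBlocks_zero₁₂ [DecidableEq κ] {A : Matrix ι ι ℝ} {D : Matrix κ κ ℝ}
    (hA : IsHurwitz A) (hD : IsHurwitz D) (C : Matrix κ ι ℝ) :
    IsHurwitz (Matrix.fromBlocks A 0 C D) := by
  rw [isHurwitz_iff_mulVec] at hA hD ⊢
  intro μ hμ x hx
  rw [toC, Matrix.fromBlocks_map, Matrix.fromBlocks_mulVec] at hx
  have h1 : x ∘ Sum.inl = 0 := by
    apply hA μ hμ
    funext i
    have := congrFun hx (Sum.inl i)
    simpa using this
  have h2 : x ∘ Sum.inr = 0 := by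
    apply hD μ hμ
    funext i
    have := congrFun hx (Sum.inr i)
    simpa [h1] using this
  funext i
  rcases i with i | i
  · exact congrFun h1 i
  · exact congrFun h2 i

theorem mulVec_pow_of_eigen {A : Matrix ι ι ℂ} {μ : ℂ} {x : ι → ℂ} (h : A *ᵥ x = μ • x) (k : ℕ) :
    A ^ k *ᵥ x = μ ^ k • x := by
  induction k with
  | zero => simp
  | succ k ih =>
    rw [pow_succ', ← Matrix.mulVec_mulVec, ih, Matrix.mulVec_smul, h, smul_smul, pow_succ]

theorem toC_pow (A : Matrix ι ι ℝ) (k : ℕ) : toC (A ^ k) = toC A ^ k :=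
  Matrix.map_pow (f := Complex.ofRealHom) A k

end Spectra

/-! ### Rank conditions -/

theorem eq_zero_of_vecMul_eq_zero {ι κ : Type*} [Fintype ι] [Fintype κ] {K : Type*} [Field K]
    {A : Matrix ι κ K} (h : A.rank = Fintype.card ι) {w : ι → K} (hw : w ᵥ* A = 0) : w = 0 := by
  have hli : LinearIndependent K A.row := by
    rw [linearIndependent_iff_card_eq_finrank_span, Set.finrank, ← h,
      Matrix.rank_eq_finrank_span_row]
  exact Matrix.vecMul_injective_iff.2 hli (by simpa using hw)

theorem eq_zero_of_mulVec_eq_zero {ι κ : Type*} [Fintype ι] [Fintype κ] {K : Type*} [Field K]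
    {A : Matrix κ ι K} (h : A.rank = Fintype.card ι) {w : ι → K} (hw : A *ᵥ w = 0) : w = 0 :=
  eq_zero_of_vecMul_eq_zero (A := Aᵀ) (by rw [Matrix.rank_transpose, h])
    (by rw [Matrix.vecMul_transpose, hw])

/-- The Hautus test: an observable pair has no unobservable eigenvector. -/
theorem IsObservable.eigen_eq_zero {n p : ℕ} {A : Matrix (Fin n) (Fin n) ℝ}
    {C : Matrix (Fin p) (Fin n) ℝ} (h : IsObservable A C) {μ : ℂ} {x : Fin n → ℂ}
    (hx : toC A *ᵥ x = μ • x) (hC : toC C *ᵥ x = 0) : x = 0 := by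
  refine toC_mulVec_injective
    (fun y hy => eq_zero_of_mulVec_eq_zero (by rw [Fintype.card_fin]; exact h) hy) x ?_
  funext ki
  have : toC (C * A ^ (ki.1 : ℕ)) *ᵥ x = 0 := by
    rw [toC_mul, toC_pow, ← Matrix.mulVec_mulVec, mulVec_pow_of_eigen hx, Matrix.mulVec_smul, hC,
      smul_zero]
  exact congrFun this ki.2

/-- The Hautus test: a controllable pair has no uncontrollable left eigenvector. -/
theorem IsControllable.eigen_eq_zero {n m : ℕ} {A : Matrix (Fin n) (Fin n) ℝ}
    {B : Matrix (Fin n) (Fin m) ℝ} (h : IsControllable A B) {μ : ℂ} {w : Fin n → ℂ}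
    (hw : w ᵥ* toC A = μ • w) (hB : w ᵥ* toC B = 0) : w = 0 := by
  refine IsObservable.eigen_eq_zero (A := Aᵀ) (C := Bᵀ) ?_ (μ := μ) (x := w)
    (by rw [← toC_transpose, Matrix.mulVec_transpose, hw])
    (by rw [← toC_transpose, Matrix.mulVec_transpose, hB])
  rw [IsControllable, ← Matrix.rank_transpose] at h
  refine Eq.trans (congrArg Matrix.rank ?_) h
  ext ki j
  simp [← Matrix.transpose_pow, ← Matrix.transpose_mul]

/-! ### Positive quadratic forms of real matrices -/

section QuadraticForms

variable {ι : Type} [Fintype ι]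

/-- The (not necessarily symmetric) real matrices with positive definite quadratic form. -/
def positiveForms (ι : Type) [Fintype ι] : Set (Matrix ι ι ℝ) :=
  {Q | ∀ x, x ≠ 0 → 0 < x ⬝ᵥ Q *ᵥ x}

theorem abs_form_le (Q : Matrix ι ι ℝ) (x : ι → ℝ) :
    |x ⬝ᵥ Q *ᵥ x| ≤ (∑ i, ∑ j, |Q i j|) * ‖x‖ ^ 2 := by
  simp only [dotProduct, Matrix.mulVec, Finset.mul_sum, Finset.sum_mul]
  refine (Finset.abs_sum_le_sum_abs _ _).trans (Finset.sum_le_sum fun i _ => ?_)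
  refine (Finset.abs_sum_le_sum_abs _ _).trans (Finset.sum_le_sum fun j _ => ?_)
  rw [abs_mul, abs_mul]
  have hi : |x i| ≤ ‖x‖ := norm_le_pi_norm x i
  have hj : |x j| ≤ ‖x‖ := norm_le_pi_norm x j
  calc |x i| * (|Q i j| * |x j|) = |Q i j| * (|x i| * |x j|) := by ring
    _ ≤ |Q i j| * (‖x‖ * ‖x‖) := by gcongr
    _ = |Q i j| * ‖x‖ ^ 2 := by ring

theorem continuous_form (Q : Matrix ι ι ℝ) : Continuous fun x : ι → ℝ => x ⬝ᵥ Q *ᵥ x := by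
  simp only [dotProduct, Matrix.mulVec]
  fun_prop

theorem exists_coercive {Q : Matrix ι ι ℝ} (hQ : Q ∈ positiveForms ι) :
    ∃ c > 0, ∀ x, c * ‖x‖ ^ 2 ≤ x ⬝ᵥ Q *ᵥ x := by
  -- The unit sphere is empty exactly when `ι` is; otherwise `c` is the minimum of the form on it.
  rcases (Metric.sphere (0 : ι → ℝ) 1).eq_empty_or_nonempty with he | hne
  · refine ⟨1, one_pos, fun x => ?_⟩
    have hx : x = 0 := by
      by_contra hx
      have : ‖x‖⁻¹ • x ∈ Metric.sphere (0 : ι → ℝ) 1 := by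
        rw [mem_sphere_zero_iff_norm, norm_smul, norm_inv, norm_norm,
          inv_mul_cancel₀ (norm_ne_zero_iff.2 hx)]
      simp [he] at this
    simp [hx]
  · obtain ⟨y, hy, hmin⟩ := (isCompact_sphere (0 : ι → ℝ) 1).exists_isMinOn hne
      (continuous_form Q).continuousOn
    have hy0 : y ≠ 0 := by
      rintro rfl
      simp at hy
    refine ⟨_, hQ y hy0, fun x => ?_⟩
    by_cases hx : x = 0
    · simp [hx]
    have hx' := norm_ne_zero_iff.2 hx
    have hmem : ‖x‖⁻¹ • x ∈ Metric.sphere (0 : ι → ℝ) 1 := by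
      rw [mem_sphere_zero_iff_norm, norm_smul, norm_inv, norm_norm, inv_mul_cancel₀ hx']
    have := hmin hmem
    simp only [Set.mem_ofPred_eq, Matrix.mulVec_smul, dotProduct_smul, smul_dotProduct,
      smul_eq_mul] at this
    calc _ ≤ (‖x‖⁻¹ * (‖x‖⁻¹ * (x ⬝ᵥ Q *ᵥ x))) * ‖x‖ ^ 2 := by gcongr
      _ = _ := by field_simp

/-- A perturbation whose entries sum in absolute value to less than the coercivity constant keeps
the form positive. Symmetry is not imposed on these forms, so the set is open among all matrices, as
the Hahn-Banach separation requires. -/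
theorem isOpen_positiveForms : IsOpen (positiveForms ι) := by
  rw [isOpen_iff_mem_nhds]
  intro Q hQ
  obtain ⟨c, hc, hQc⟩ := exists_coercive hQ
  have hcont : Continuous fun R : Matrix ι ι ℝ => ∑ i, ∑ j, |(R - Q) i j| := by
    simp only [Matrix.sub_apply]
    fun_prop
  have hlt : ∀ᶠ R in nhds Q, ∑ i, ∑ j, |(R - Q) i j| < c :=
    hcont.continuousAt.eventually_lt continuousAt_const (by simpa using hc)
  filter_upwards [hlt] with R hR x hx
  have h1 := abs_form_le (R - Q) x
  have h2 := hQc x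
  have h3 : x ⬝ᵥ R *ᵥ x = x ⬝ᵥ Q *ᵥ x + x ⬝ᵥ (R - Q) *ᵥ x := by
    rw [Matrix.sub_mulVec, dotProduct_sub]
    ring
  have hx' : 0 < ‖x‖ ^ 2 := by positivity
  nlinarith [neg_abs_le (x ⬝ᵥ (R - Q) *ᵥ x)]

theorem positiveForms_add_smul {P Q : Matrix ι ι ℝ} (hP : P ∈ positiveForms ι)
    (hQ : ∀ x, 0 ≤ x ⬝ᵥ Q *ᵥ x) {a b : ℝ} (ha : 0 < a) (hb : 0 ≤ b) :
    a • P + b • Q ∈ positiveForms ι := by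
  intro x hx
  rw [Matrix.add_mulVec, Matrix.smul_mulVec, Matrix.smul_mulVec, dotProduct_add, dotProduct_smul,
    dotProduct_smul]
  exact add_pos_of_pos_of_nonneg (mul_pos ha (hP x hx)) (mul_nonneg hb (hQ x))

theorem convex_positiveForms : Convex ℝ (positiveForms ι) := by
  intro P hP Q hQ a b ha hb hab
  have hnn : ∀ {R : Matrix ι ι ℝ}, R ∈ positiveForms ι → ∀ x, 0 ≤ x ⬝ᵥ R *ᵥ x := by
    intro R hR x
    by_cases hx : x = 0
    · simp [hx]
    · exact (hR x hx).le
  rcases ha.eq_or_lt with rfl | ha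
  · rw [zero_add] at hab
    simpa [hab] using hQ
  · exact positiveForms_add_smul hP (hnn hQ) ha hb

theorem one_mem_positiveForms [DecidableEq ι] : (1 : Matrix ι ι ℝ) ∈ positiveForms ι := by
  intro x hx
  rw [Matrix.one_mulVec]
  exact (Matrix.dotProduct_self_star_pos_iff (v := x)).2 hx

theorem eq_zero_of_forall_linear_nonneg {a b : ℝ} (h : ∀ t : ℝ, 0 ≤ a + t * b) : b = 0 := by
  by_contra hb
  -- At this `t` the affine function takes the value `-1`.
  have := h (-(a + 1) / b)
  rw [div_mul_cancel₀ _ hb] at this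
  linarith

theorem nonneg_of_forall_pos_add {a b : ℝ} (h : ∀ ε : ℝ, 0 < ε → 0 ≤ a + ε * b) : 0 ≤ a := by
  have hc : Filter.Tendsto (fun ε : ℝ => a + ε * b) (nhdsWithin 0 (Set.Ioi 0)) (nhds (a + 0 * b)) :=
    ((by fun_prop : Continuous fun ε : ℝ => a + ε * b).tendsto 0).mono_left nhdsWithin_le_nhds
  rw [zero_mul, add_zero] at hc
  exact ge_of_tendsto hc (Filter.eventually_of_mem self_mem_nhdsWithin h)

/-- If a nonnegative quadratic form vanishes at `x`, and its two one-sided polar forms at `x` are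
nonnegatively proportional, then its matrix kills `x`. -/
theorem mulVec_eq_zero_of_form_eq_zero {Q : Matrix ι ι ℝ} (hQ : ∀ x, 0 ≤ x ⬝ᵥ Q *ᵥ x)
    {x : ι → ℝ} (hx : x ⬝ᵥ Q *ᵥ x = 0) {c : ℝ} (hc : 0 ≤ c)
    (hxy : ∀ y, x ⬝ᵥ Q *ᵥ y = c * (y ⬝ᵥ Q *ᵥ x)) : Q *ᵥ x = 0 := by
  -- Expand the form at `x + t y`, divide by `t > 0` and let `t` tend to `0`: only the polar terms,
  -- `1 + c` times this one, survive. Then test with `y = -Q x`.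
  have key : ∀ y, 0 ≤ y ⬝ᵥ Q *ᵥ x := by
    intro y
    have hb : ∀ t : ℝ, 0 < t → 0 ≤ (1 + c) * (y ⬝ᵥ Q *ᵥ x) + t * (y ⬝ᵥ Q *ᵥ y) := by
      intro t ht
      have h0 := hQ (x + t • y)
      simp only [Matrix.mulVec_add, Matrix.mulVec_smul, add_dotProduct, dotProduct_add,
        smul_dotProduct, dotProduct_smul, hx, hxy y, smul_eq_mul] at h0
      have h2 : 0 ≤ t * ((1 + c) * (y ⬝ᵥ Q *ᵥ x) + t * (y ⬝ᵥ Q *ᵥ y)) := by linarith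
      exact nonneg_of_mul_nonneg_right h2 ht
    exact nonneg_of_mul_nonneg_right (nonneg_of_forall_pos_add hb) (by linarith)
  have h1 := key (-(Q *ᵥ x))
  rw [neg_dotProduct] at h1
  exact dotProduct_self_eq_zero.1 (le_antisymm (by linarith) (key _))

theorem re_star_dotProduct_toC (Q : Matrix ι ι ℝ) (u : ι → ℂ) :
    (star u ⬝ᵥ toC Q *ᵥ u).re = (fun i => (u i).re) ⬝ᵥ Q *ᵥ (fun i => (u i).re) +
      (fun i => (u i).im) ⬝ᵥ Q *ᵥ (fun i => (u i).im) := by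
  simp only [dotProduct, Pi.star_apply, Complex.re_sum, Complex.mul_re, re_toC_mulVec,
    im_toC_mulVec, Complex.star_def, Complex.conj_re, Complex.conj_im, ← Finset.sum_add_distrib]
  exact Finset.sum_congr rfl fun i _ => by ring

theorem im_star_dotProduct_toC {Q : Matrix ι ι ℝ} (hQ : Qᵀ = Q) (u : ι → ℂ) :
    (star u ⬝ᵥ toC Q *ᵥ u).im = 0 := by
  have h : (fun i => (u i).re) ⬝ᵥ Q *ᵥ (fun i => (u i).im) =
      (fun i => (u i).im) ⬝ᵥ Q *ᵥ (fun i => (u i).re) := by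
    rw [Matrix.dotProduct_mulVec, ← Matrix.mulVec_transpose, hQ, dotProduct_comm]
  rw [← sub_eq_zero] at h
  rw [← h]
  simp only [dotProduct, Pi.star_apply, Complex.im_sum, Complex.mul_im, re_toC_mulVec,
    im_toC_mulVec, Complex.star_def, Complex.conj_re, Complex.conj_im, ← Finset.sum_sub_distrib]
  exact Finset.sum_congr rfl fun i _ => by ring

theorem trace_mul_vecMulVec (Q : Matrix ι ι ℝ) (x y : ι → ℝ) :
    (Q * Matrix.vecMulVec x y).trace = y ⬝ᵥ Q *ᵥ x := by
  rw [Matrix.mul_vecMulVec, Matrix.trace_vecMulVec, dotProduct_comm]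

theorem form_vecMulVec (x y : ι → ℝ) : 0 ≤ y ⬝ᵥ Matrix.vecMulVec x x *ᵥ y := by
  rw [Matrix.vecMulVec_mulVec, dotProduct_smul, dotProduct_comm]
  exact mul_self_nonneg _

end QuadraticForms

/-! ### The Hautus test and Lyapunov inequalities -/

section Stabilization

variable {ι κ : Type} [Fintype ι] [DecidableEq ι]

/-- The Hautus condition for stabilizability: no left eigenvector of `A` belonging to an
eigenvalue with nonnegative real part is annihilated by `B`. -/
def HautusStabilizable (A : Matrix ι ι ℝ) (B : Matrix ι κ ℝ) : Prop :=
  ∀ μ : ℂ, 0 ≤ μ.re → ∀ w : ι → ℂ, w ᵥ* toC A = μ • w → w ᵥ* toC B = 0 → w = 0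

theorem IsStabilizable.hautus [Fintype κ] {A : Matrix ι ι ℝ} {B : Matrix ι κ ℝ}
    (h : IsStabilizable A B) :
    HautusStabilizable A B := by
  obtain ⟨K, hK⟩ := h
  rw [isHurwitz_iff_vecMul] at hK
  intro μ hμ w hA hB
  refine hK μ hμ w ?_
  rw [toC_add, toC_mul, Matrix.vecMul_add, hA, ← Matrix.vecMul_vecMul, hB, Matrix.zero_vecMul,
    add_zero]

/-- `W` descends to the quotient by the kernel of `Z`, which is the range of `Z`; the resulting map
extends from there to the whole space. -/
theorem exists_mul_eq_of_ker_le {Z W : Matrix ι ι ℝ} (h : ∀ x, Z *ᵥ x = 0 → W *ᵥ x = 0) :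
    ∃ X : Matrix ι ι ℝ, X * Z = W := by
  have hk : LinearMap.ker Z.toLin' ≤ LinearMap.ker W.toLin' := fun x hx => by
    simpa using h x (by simpa using hx)
  obtain ⟨g, hg⟩ := LinearMap.exists_extend
    ((Submodule.liftQ _ W.toLin' hk) ∘ₗ Z.toLin'.quotKerEquivRange.symm.toLinearMap)
  refine ⟨LinearMap.toMatrix' g, Matrix.toLin'.injective ?_⟩
  rw [Matrix.toLin'_mul, Matrix.toLin'_toMatrix']
  refine LinearMap.ext fun x => ?_
  have hx := LinearMap.congr_fun hg (Z.toLin'.quotKerEquivRange (Submodule.Quotient.mk x))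
  rw [LinearMap.comp_apply, LinearMap.comp_apply, LinearEquiv.coe_coe,
    LinearEquiv.symm_apply_apply] at hx
  exact hx

/-- A matrix leaving the range of `Z ≠ 0` invariant has an eigenvector in that range. -/
theorem exists_eigenvector_mem_range {A Z X : Matrix ι ι ℂ} (h : A * Z = Z * X) (hZ : Z ≠ 0) :
    ∃ (μ : ℂ) (u : ι → ℂ), Z *ᵥ u ≠ 0 ∧ A *ᵥ (Z *ᵥ u) = μ • (Z *ᵥ u) := by
  have hmap : ∀ x ∈ LinearMap.range Z.toLin', A.toLin' x ∈ LinearMap.range Z.toLin' := by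
    rintro _ ⟨u, rfl⟩
    refine ⟨X *ᵥ u, ?_⟩
    simp only [Matrix.toLin'_apply, Matrix.mulVec_mulVec, h]
  have hne : Nontrivial (LinearMap.range Z.toLin') := by
    rw [Submodule.nontrivial_iff_ne_bot, ne_eq, LinearMap.range_eq_bot]
    simpa using hZ
  obtain ⟨μ, hμ⟩ := Module.End.exists_eigenvalue (A.toLin'.restrict hmap)
  obtain ⟨⟨_, u, rfl⟩, hw, hw0⟩ := hμ.exists_hasEigenvector
  rw [Module.End.mem_eigenspace_iff] at hw
  refine ⟨μ, u, fun h0 => hw0 (Subtype.ext (by simpa using h0)), ?_⟩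
  simpa using congrArg Subtype.val hw

/-- The obstruction dual to the stabilization inequality contradicts the Hautus condition. -/
theorem HautusStabilizable.dual_eq_zero {A : Matrix ι ι ℝ} {B : Matrix ι κ ℝ}
    (h : HautusStabilizable A B) {Z : Matrix ι ι ℝ} (hsymm : Zᵀ = Z)
    (hpos : ∀ x, 0 ≤ x ⬝ᵥ Z *ᵥ x) (hB : Z * B = 0) (hA : ∀ x, 0 ≤ x ⬝ᵥ (Z * A) *ᵥ x) :
    Z = 0 := by
  by_contra hZ
  have hswap : ∀ x y : ι → ℝ, x ⬝ᵥ Z *ᵥ y = (Z *ᵥ x) ⬝ᵥ y := by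
    intro x y
    rw [Matrix.dotProduct_mulVec, ← Matrix.mulVec_transpose, hsymm]
  -- For `Z x = 0`, symmetry gives `xᵀ Z A = 0`; the form of `Z A` vanishes at `x` with one polar
  -- form zero, so `c = 0` applies.
  have hker : ∀ x, Z *ᵥ x = 0 → (Z * A) *ᵥ x = 0 := by
    intro x hx
    have h1 : ∀ y, x ⬝ᵥ (Z * A) *ᵥ y = 0 := by
      intro y
      rw [← Matrix.mulVec_mulVec, hswap, hx, zero_dotProduct]
    exact mulVec_eq_zero_of_form_eq_zero hA (h1 x) le_rfl fun y => by rw [h1, zero_mul]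
  have hdef : ∀ x, x ⬝ᵥ Z *ᵥ x = 0 → Z *ᵥ x = 0 := fun x hx =>
    mulVec_eq_zero_of_form_eq_zero hpos hx zero_le_one fun y => by
      rw [hswap, dotProduct_comm, one_mul]
  -- Transposing `X Z = Z A` shows that `Aᵀ` leaves the range of `Z` invariant, so `Aᵀ` has an
  -- eigenvector `Z u` there.
  obtain ⟨X, hX⟩ := exists_mul_eq_of_ker_le hker
  have hX' : Aᵀ * Z = Z * Xᵀ := by
    have := congrArg Matrix.transpose hX
    rw [Matrix.transpose_mul, Matrix.transpose_mul, hsymm] at this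
    exact this.symm
  obtain ⟨μ, u, hu0, hu⟩ := exists_eigenvector_mem_range (A := toC Aᵀ) (Z := toC Z) (X := toC Xᵀ)
    (by rw [← toC_mul, hX', toC_mul]) (fun h0 => hZ (toC_injective (by rw [h0]; ext; simp)))
  refine hu0 (h μ ?_ _ ?_ ?_)
  -- Pairing the eigenvector equation with `u` gives `u* Aᵀ Z u = μ (u* Z u)`. The left side has
  -- nonnegative real part and `u* Z u` is real and positive, whence `Re μ ≥ 0`.
  · have h1 : star u ⬝ᵥ toC (Aᵀ * Z) *ᵥ u = μ * (star u ⬝ᵥ toC Z *ᵥ u) := by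
      rw [toC_mul, ← Matrix.mulVec_mulVec, hu, dotProduct_smul, smul_eq_mul]
    have h2 := congrArg Complex.re h1
    rw [Complex.mul_re, im_star_dotProduct_toC hsymm, mul_zero, sub_zero, re_star_dotProduct_toC,
      re_star_dotProduct_toC] at h2
    have h3 : ∀ x, 0 ≤ x ⬝ᵥ (Aᵀ * Z) *ᵥ x := by
      intro x
      have : Aᵀ * Z = (Z * A)ᵀ := by rw [Matrix.transpose_mul, hsymm]
      rw [this, Matrix.mulVec_transpose, dotProduct_comm, ← Matrix.dotProduct_mulVec]
      exact hA x
    set a : ι → ℝ := fun i => (u i).re with ha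
    set b : ι → ℝ := fun i => (u i).im with hb
    have hab : 0 < a ⬝ᵥ Z *ᵥ a + b ⬝ᵥ Z *ᵥ b := by
      refine lt_of_le_of_ne (add_nonneg (hpos a) (hpos b)) fun h0 => hu0 ?_
      rw [toC_mulVec_eq_zero_iff]
      have h4 := hpos a
      have h5 := hpos b
      exact ⟨hdef a (by linarith), hdef b (by linarith)⟩
    have h4 : 0 ≤ μ.re * (a ⬝ᵥ Z *ᵥ a + b ⬝ᵥ Z *ᵥ b) := h2 ▸ add_nonneg (h3 a) (h3 b)
    exact nonneg_of_mul_nonneg_left h4 hab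
  · rw [← hu, ← toC_transpose, Matrix.mulVec_transpose]
  · rw [← Matrix.mulVec_transpose, toC_transpose, Matrix.mulVec_mulVec, ← toC_mul]
    have : Bᵀ * Z = 0 := by
      rw [← hsymm, ← Matrix.transpose_mul, hB, Matrix.transpose_zero]
    rw [this]
    funext i
    simp [Matrix.mulVec, dotProduct]

/-- The functional `N ↦ tr (Z N)` representing a linear functional on matrices. -/
theorem exists_trace_representation (f : Matrix ι ι ℝ →ₗ[ℝ] ℝ) :
    ∃ Z : Matrix ι ι ℝ, ∀ N, f N = (Z * N).trace := by
  refine ⟨Matrix.of fun j i => f (Matrix.single i j 1), fun N => ?_⟩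
  conv_lhs => rw [Matrix.matrix_eq_sum_single N]
  simp only [map_sum, Matrix.trace, Matrix.diag_apply, Matrix.mul_apply, Matrix.of_apply]
  rw [Finset.sum_comm]
  refine Finset.sum_congr rfl fun j _ => Finset.sum_congr rfl fun i _ => ?_
  have : Matrix.single i j (N i j) = N i j • Matrix.single i j (1 : ℝ) := by
    rw [Matrix.smul_single, smul_eq_mul, mul_one]
  rw [this, map_smul, smul_eq_mul, mul_comm]

open scoped Pointwise in
/-- The stabilization inequality: the Hautus condition yields a symmetric positive definite `P`
and a `Y` such that `-(A P + B Y)` has positive definite quadratic form. -/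
theorem HautusStabilizable.exists_lyapunov [Fintype κ] [DecidableEq κ] {A : Matrix ι ι ℝ}
    {B : Matrix ι κ ℝ} (h : HautusStabilizable A B) :
    ∃ (P : Matrix ι ι ℝ) (Y : Matrix κ ι ℝ), Pᵀ = P ∧ P ∈ positiveForms ι ∧
      -(A * P + B * Y) ∈ positiveForms ι := by
  by_contra hcon
  push Not at hcon
  set S₁ : Set (Matrix ι ι ℝ) :=
    {R | ∃ (P : Matrix ι ι ℝ) (Y : Matrix κ ι ℝ), Pᵀ = P ∧ P ∈ positiveForms ι ∧
      A * P + B * Y = R} with hS₁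
  have hconv : Convex ℝ S₁ := by
    rintro _ ⟨P, Y, hP, hP', rfl⟩ _ ⟨P₂, Y₂, hP₂, hP₂', rfl⟩ a b ha hb hab
    refine ⟨a • P + b • P₂, a • Y + b • Y₂, ?_, convex_positiveForms hP' hP₂' ha hb hab, ?_⟩
    · rw [Matrix.transpose_add, Matrix.transpose_smul, Matrix.transpose_smul, hP, hP₂]
    · simp only [Matrix.mul_add, Matrix.mul_smul, smul_add]
      abel
  have h0 : (0 : Matrix ι ι ℝ) ∉ S₁ + positiveForms ι := by
    rintro ⟨_, ⟨P, Y, hP, hP', rfl⟩, Q, hQ, hsum⟩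
    refine hcon P Y hP hP' ?_
    rw [neg_eq_of_add_eq_zero_right hsum]
    exact hQ
  -- Infeasibility means that `0` is not of the form `A P + B Y + Q` with `P`, `Q` positive. Such
  -- matrices form an open convex set, on which `f` is negative; `Z` represents `-f`.
  obtain ⟨f, hf⟩ := geometric_hahn_banach_open_point (hconv.add convex_positiveForms)
    isOpen_positiveForms.add_left h0
  rw [map_zero] at hf
  obtain ⟨Z, hZ⟩ := exists_trace_representation (-f.toLinearMap)
  have hpos : ∀ P Q : Matrix ι ι ℝ, ∀ Y : Matrix κ ι ℝ, Pᵀ = P → P ∈ positiveForms ι →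
      Q ∈ positiveForms ι → 0 < (Z * (A * P + B * Y + Q)).trace := by
    intro P Q Y hP hP' hQ
    rw [← hZ]
    exact neg_pos.2 (hf _ (Set.add_mem_add ⟨P, Y, hP, hP', rfl⟩ hQ))
  have h1 := one_mem_positiveForms (ι := ι)
  -- `Y` ranges over a linear space, so its contribution to the trace must vanish.
  have hB : Z * B = 0 := by
    have key : ∀ Y : Matrix κ ι ℝ, (Z * B * Y).trace = 0 := by
      intro Y
      refine eq_zero_of_forall_linear_nonneg (a := (Z * (A * 1 + 1)).trace) fun t => ?_
      have := hpos 1 1 (t • Y) Matrix.transpose_one h1 h1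
      rw [add_right_comm, Matrix.mul_add, Matrix.trace_add, Matrix.mul_smul, Matrix.mul_smul,
        Matrix.trace_smul, ← Matrix.mul_assoc, smul_eq_mul] at this
      exact this.le
    ext i j
    have := key (Matrix.single j i 1)
    simpa [Matrix.trace_mul_single] using this
  -- Adding `ε` times the identity and letting `ε` tend to `0` admits semidefinite `P` and `Q`.
  have hA : ∀ P Q : Matrix ι ι ℝ, Pᵀ = P → (∀ x, 0 ≤ x ⬝ᵥ P *ᵥ x) → (∀ x, 0 ≤ x ⬝ᵥ Q *ᵥ x) →
      0 ≤ (Z * (A * P + Q)).trace := by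
    intro P Q hP hP' hQ
    refine nonneg_of_forall_pos_add (b := (Z * (A * 1 + 1)).trace) fun ε hε => ?_
    have := hpos (ε • 1 + (1 : ℝ) • P) (ε • 1 + (1 : ℝ) • Q) 0 (by simp [hP])
      (positiveForms_add_smul h1 hP' hε zero_le_one) (positiveForms_add_smul h1 hQ hε zero_le_one)
    rw [← smul_eq_mul ε, ← Matrix.trace_smul, ← Matrix.trace_add, ← Matrix.mul_smul, ← Matrix.mul_add]
    refine this.le.trans_eq (congrArg _ (congrArg _ ?_))
    simp only [Matrix.mul_add, Matrix.mul_smul, Matrix.mul_zero, one_smul, smul_add]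
    abel
  have hz : ∀ x : ι → ℝ, (0 : ℝ) ≤ x ⬝ᵥ (0 : Matrix ι ι ℝ) *ᵥ x := by simp
  -- Every multiple of a skew matrix has zero form and is therefore an admissible `Q`; so `Z`
  -- annihilates skew matrices under the trace.
  have hZsymm : Zᵀ = Z := by
    ext i j
    have key := eq_zero_of_forall_linear_nonneg (a := 0)
      (b := (Z * (Matrix.single i j 1 - Matrix.single j i 1)).trace) fun t => by
        have := hA 0 (t • (Matrix.single i j 1 - Matrix.single j i 1)) Matrix.transpose_zero hz
          fun x => by
            rw [Matrix.smul_mulVec, Matrix.sub_mulVec, dotProduct_smul, dotProduct_sub,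
              Matrix.single_mulVec, Matrix.single_mulVec]
            change 0 ≤ t * (x ⬝ᵥ Pi.single i (1 * x j) - x ⬝ᵥ Pi.single j (1 * x i))
            simp [mul_comm]
        simpa using this
    rw [Matrix.mul_sub, Matrix.trace_sub, Matrix.trace_mul_single, Matrix.trace_mul_single] at key
    simp at key
    simp
    linarith
  -- A rank-one `Q` shows that the form of `Z` is nonnegative, a rank-one `P` that the form of `Z A`
  -- is.
  have hZ0 := h.dual_eq_zero hZsymm
    (fun x => by
      have := hA 0 (Matrix.vecMulVec x x) Matrix.transpose_zero hz (form_vecMulVec x)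
      rwa [Matrix.mul_zero, zero_add, trace_mul_vecMulVec] at this) hB
    (fun x => by
      have := hA (Matrix.vecMulVec x x) 0 (Matrix.transpose_vecMulVec x x) (form_vecMulVec x) hz
      rwa [add_zero, ← Matrix.mul_assoc, trace_mul_vecMulVec] at this)
  have := hpos 1 1 0 Matrix.transpose_one h1 h1
  simp [hZ0] at this

/-- For a left eigenvector `w`, `w A P w* = μ (w P w*)`, where `w P w*` is real and positive and the
left side has negative real part. -/
theorem isHurwitz_of_lyapunov {A P : Matrix ι ι ℝ} (hP : Pᵀ = P) (hP' : P ∈ positiveForms ι)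
    (h : -(A * P) ∈ positiveForms ι) : IsHurwitz A := by
  rw [isHurwitz_iff_vecMul]
  intro μ hμ w hw
  by_contra hw0
  set u : ι → ℂ := star w with hu
  have hu0 : (fun i => (u i).re) ≠ 0 ∨ (fun i => (u i).im) ≠ 0 := by
    by_contra hcon
    push Not at hcon
    refine hw0 ?_
    rw [← star_eq_zero]
    funext i
    exact Complex.ext (congrFun hcon.1 i) (congrFun hcon.2 i)
  have hpos : ∀ Q ∈ positiveForms ι, 0 < (star u ⬝ᵥ toC Q *ᵥ u).re := by
    intro Q hQ
    have hnn : ∀ x, 0 ≤ x ⬝ᵥ Q *ᵥ x := fun x => by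
      by_cases hx : x = 0
      · simp [hx]
      · exact (hQ x hx).le
    rw [re_star_dotProduct_toC]
    rcases hu0 with h0 | h0
    · exact add_pos_of_pos_of_nonneg (hQ _ h0) (hnn _)
    · exact add_pos_of_nonneg_of_pos (hnn _) (hQ _ h0)
  have h1 := hpos _ h
  have h2 := hpos _ hP'
  have h3 : star u ⬝ᵥ toC (-(A * P)) *ᵥ u = -(μ * (star u ⬝ᵥ toC P *ᵥ u)) := by
    have : toC (-(A * P)) = -(toC A * toC P) := by
      rw [← toC_mul]
      ext
      simp
    rw [this, Matrix.neg_mulVec, dotProduct_neg, ← Matrix.mulVec_mulVec, Matrix.dotProduct_mulVec,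
      hu, star_star, hw, smul_dotProduct, smul_eq_mul]
  rw [h3, Complex.neg_re, Complex.mul_re, im_star_dotProduct_toC hP] at h1
  nlinarith

/-- The Hautus condition implies stabilizability. -/
theorem HautusStabilizable.isStabilizable [Fintype κ] [DecidableEq κ] {A : Matrix ι ι ℝ}
    {B : Matrix ι κ ℝ} (h : HautusStabilizable A B) : IsStabilizable A B := by
  obtain ⟨P, Y, hP, hP', hY⟩ := h.exists_lyapunov
  have hdet : IsUnit P.det := by
    rw [isUnit_iff_ne_zero]
    intro h0
    obtain ⟨x, hx, hx'⟩ := Matrix.exists_mulVec_eq_zero_iff.2 h0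
    have := hP' x hx
    simp [hx'] at this
  -- With `K = Y P⁻¹`, `(A + B K) P = A P + B Y`.
  refine ⟨Y * P⁻¹, isHurwitz_of_lyapunov hP hP' ?_⟩
  rwa [Matrix.add_mul, ← Matrix.mul_assoc, Matrix.mul_assoc (B * Y), Matrix.nonsing_inv_mul _ hdet,
    Matrix.mul_one]

/-- The Lyapunov inequality for a Hurwitz matrix. -/
theorem IsHurwitz.exists_lyapunov {A : Matrix ι ι ℝ} (h : IsHurwitz A) :
    ∃ P : Matrix ι ι ℝ, Pᵀ = P ∧ P ∈ positiveForms ι ∧ -(P * A) ∈ positiveForms ι := by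
  -- A system without inputs: the Hautus condition then just excludes eigenvalues in the closed
  -- right half-plane.
  have hH : HautusStabilizable Aᵀ (0 : Matrix ι (Fin 0) ℝ) := fun μ hμ w hw _ =>
    (isHurwitz_iff_vecMul _).1 h.transpose μ hμ w hw
  obtain ⟨P, Y, hP, hP', hPA⟩ := hH.exists_lyapunov
  refine ⟨P, hP, hP', fun x hx => ?_⟩
  have := hPA x hx
  have heq : -(Aᵀ * P + (0 : Matrix ι (Fin 0) ℝ) * Y) = (-(P * A))ᵀ := by
    rw [Matrix.zero_mul, add_zero, Matrix.transpose_neg, Matrix.transpose_mul, hP]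
  rwa [heq, Matrix.mulVec_transpose, dotProduct_comm, ← Matrix.dotProduct_mulVec] at this

end Stabilization

/-! ### Exponential decay from a Lyapunov function -/

section Decay

variable {ι κ : Type} [Fintype ι]

theorem hasDerivWithinAt_mulVec [Finite κ] (A : Matrix κ ι ℝ) {f : ℝ → ι → ℝ} {f' : ι → ℝ}
    {s : Set ℝ} {t : ℝ} (hf : HasDerivWithinAt f f' s t) :
    HasDerivWithinAt (fun t => A *ᵥ f t) (A *ᵥ f') s t := by
  have := Fintype.ofFinite κ
  rw [hasDerivWithinAt_pi] at hf ⊢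
  intro i
  simp only [Matrix.mulVec, dotProduct]
  exact HasDerivWithinAt.fun_sum fun j _ => (hf j).const_mul _

theorem hasDerivWithinAt_dotProduct {f g : ℝ → ι → ℝ} {f' g' : ι → ℝ} {s : Set ℝ} {t : ℝ}
    (hf : HasDerivWithinAt f f' s t) (hg : HasDerivWithinAt g g' s t) :
    HasDerivWithinAt (fun t => f t ⬝ᵥ g t) (f' ⬝ᵥ g t + f t ⬝ᵥ g') s t := by
  rw [hasDerivWithinAt_pi] at hf hg
  simp only [dotProduct, ← Finset.sum_add_distrib]
  exact HasDerivWithinAt.fun_sum fun j _ => (hf j).mul (hg j)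

/-- Solutions of `ẇ = A w` with `A` Hurwitz decay exponentially, uniformly in the initial value. -/
theorem IsHurwitz.exists_decay [DecidableEq ι] {A : Matrix ι ι ℝ} (h : IsHurwitz A) :
    ∃ k > 0, ∃ c > 0, ∀ W : ℝ → ι → ℝ,
      (∀ t, 0 ≤ t → HasDerivWithinAt W (A *ᵥ W t) (Set.Ici 0) t) →
        ∀ t, 0 ≤ t → ‖W t‖ ≤ k * Real.exp (-c * t) * ‖W 0‖ := by
  obtain ⟨P, hP, hPpos, hPA⟩ := h.exists_lyapunov
  obtain ⟨c₁, hc₁, hlow⟩ := exists_coercive hPpos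
  obtain ⟨c₂, hc₂, hdiss⟩ := exists_coercive hPA
  -- The summand `1` keeps `C` positive even when `ι` is empty.
  set C : ℝ := (∑ i, ∑ j, |P i j|) + 1 with hC
  have hCpos : 0 < C := by positivity
  have hup : ∀ x, x ⬝ᵥ P *ᵥ x ≤ C * ‖x‖ ^ 2 := fun x =>
    (le_abs_self _).trans ((abs_form_le P x).trans (by gcongr; simp [hC]))
  -- `V̇ ≤ -2 c₂ ‖W‖² ≤ -2 c V`, so `V exp (2 c t)` is antitone; the square root turns the rate `2
  -- c` into `c`.
  set c : ℝ := c₂ / C with hc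
  have hcpos : 0 < c := by positivity
  refine ⟨√(C / c₁), by positivity, c, hcpos, fun W hW t ht => ?_⟩
  set V : ℝ → ℝ := fun t => W t ⬝ᵥ P *ᵥ W t with hV
  have hV' : ∀ t, 0 ≤ t →
      HasDerivWithinAt V (2 * (W t ⬝ᵥ (P * A) *ᵥ W t)) (Set.Ici 0) t := by
    intro t ht
    convert hasDerivWithinAt_dotProduct (hW t ht) (hasDerivWithinAt_mulVec P (hW t ht)) using 1
    rw [two_mul, Matrix.mulVec_mulVec]
    congr 1
    rw [Matrix.dotProduct_mulVec (A *ᵥ W t), ← Matrix.mulVec_transpose, hP, Matrix.mulVec_mulVec,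
      dotProduct_comm]
  have hdec : ∀ t, 2 * (W t ⬝ᵥ (P * A) *ᵥ W t) + 2 * c * V t ≤ 0 := by
    intro t
    have h1 := hdiss (W t)
    rw [Matrix.neg_mulVec, dotProduct_neg] at h1
    have h2 : c * V t ≤ c₂ * ‖W t‖ ^ 2 := by
      calc c * V t ≤ c * (C * ‖W t‖ ^ 2) := by gcongr; exact hup _
        _ = c₂ * ‖W t‖ ^ 2 := by rw [hc]; field_simp
    linarith
  have hg' : ∀ t, 0 ≤ t → HasDerivWithinAt (fun t => V t * Real.exp (2 * c * t))
      ((2 * (W t ⬝ᵥ (P * A) *ᵥ W t) + 2 * c * V t) * Real.exp (2 * c * t)) (Set.Ici 0) t := by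
    intro t ht
    have he : HasDerivWithinAt (fun t => Real.exp (2 * c * t))
        (Real.exp (2 * c * t) * (2 * c * 1)) (Set.Ici 0) t :=
      ((hasDerivWithinAt_id t _).const_mul (2 * c)).exp
    refine ((hV' t ht).mul he).congr_deriv ?_
    ring
  have hanti : AntitoneOn (fun t => V t * Real.exp (2 * c * t)) (Set.Ici 0) :=
    antitoneOn_of_hasDerivWithinAt_nonpos (convex_Ici 0)
      (fun t ht => (hg' t ht).continuousWithinAt)
      (fun t ht => (hg' t (interior_subset ht)).mono interior_subset)
      (fun t _ => mul_nonpos_of_nonpos_of_nonneg (hdec t) (Real.exp_pos _).le)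
  have h0 : V t * Real.exp (2 * c * t) ≤ V 0 := by
    simpa using hanti (Set.self_mem_Ici (a := (0 : ℝ))) ht ht
  have hsq : ‖W t‖ ^ 2 ≤ (√(C / c₁) * Real.exp (-c * t) * ‖W 0‖) ^ 2 := by
    rw [mul_pow, mul_pow, Real.sq_sqrt (by positivity), ← Real.exp_nat_mul]
    have he : Real.exp (2 * c * t) * Real.exp ((2 : ℕ) * (-c * t)) = 1 := by
      rw [← Real.exp_add, Real.exp_eq_one_iff]
      push_cast
      ring
    have h1 : c₁ * ‖W t‖ ^ 2 ≤ C * ‖W 0‖ ^ 2 * Real.exp ((2 : ℕ) * (-c * t)) := by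
      calc c₁ * ‖W t‖ ^ 2 ≤ V t := hlow _
        _ = V t * Real.exp (2 * c * t) * Real.exp ((2 : ℕ) * (-c * t)) := by
          rw [mul_assoc, he, mul_one]
        _ ≤ V 0 * Real.exp ((2 : ℕ) * (-c * t)) := by gcongr
        _ ≤ C * ‖W 0‖ ^ 2 * Real.exp ((2 : ℕ) * (-c * t)) := by gcongr; exact hup _
    rw [mul_comm c₁, ← le_div_iff₀ hc₁] at h1
    refine h1.trans_eq ?_
    ring
  exact (sq_le_sq₀ (norm_nonneg _) (by positivity)).1 hsq

end Decay

/-! ### Sylvester equations and the internal model property -/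

section InternalModel

open Polynomial in
theorem mul_aeval_of_intertwining {ι κ : Type} [Fintype ι] [DecidableEq ι] [Fintype κ]
    [DecidableEq κ] {A : Matrix ι ι ℝ} {S : Matrix κ κ ℝ} {X : Matrix ι κ ℝ} (h : X * S = A * X)
    (p : ℝ[X]) : X * aeval S p = aeval A p * X := by
  have hpow : ∀ k : ℕ, X * S ^ k = A ^ k * X := by
    intro k
    induction k with
    | zero => simp
    | succ k ih => rw [pow_succ, ← Matrix.mul_assoc, ih, Matrix.mul_assoc, h, ← Matrix.mul_assoc,
        pow_succ]
  rw [aeval_eq_sum_range, aeval_eq_sum_range, Matrix.mul_sum, Matrix.sum_mul]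
  refine Finset.sum_congr rfl fun k _ => ?_
  rw [Matrix.mul_smul, hpow, Matrix.smul_mul]

/-- Solvability of the Sylvester equation `X S = A X + R` when `A` is Hurwitz and `S` has no
eigenvalue with negative real part. -/
theorem exists_sylvester_solution {ι κ : Type} [Fintype ι] [DecidableEq ι] [Fintype κ]
    [DecidableEq κ] {A : Matrix ι ι ℝ} (hA : IsHurwitz A) {S : Matrix κ κ ℝ}
    (hS : ∀ μ ∈ spectrum ℂ (toC S), 0 ≤ μ.re) (R : Matrix ι κ ℝ) :
    ∃ X : Matrix ι κ ℝ, X * S = A * X + R := by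
  let T : Matrix ι κ ℝ →ₗ[ℝ] Matrix ι κ ℝ :=
    { toFun := fun X => X * S - A * X
      map_add' := fun X Y => by
        rw [Matrix.add_mul, Matrix.mul_add]
        abel
      map_smul' := fun c X => by
        rw [Matrix.smul_mul, Matrix.mul_smul, ← smul_sub, RingHom.id_apply] }
  have hcop : IsCoprime A.charpoly S.charpoly := by
    refine (Polynomial.isCoprime_iff_aeval_ne_zero_of_isAlgClosed ℝ ℂ _ _).2 ?_
    intro μ
    by_contra hcon
    push Not at hcon
    rw [← mem_spectrum_iff_aeval_charpoly, ← mem_spectrum_iff_aeval_charpoly] at hcon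
    exact (hA μ hcon.1).not_ge (hS μ hcon.2)
  -- If `X S = A X`, then `X f(S) = f(A) X` for every polynomial `f`. Applied to a Bézout relation
  -- between the characteristic polynomials, Cayley-Hamilton kills both terms of `X`.
  have hinj : Function.Injective T := by
    rw [← LinearMap.ker_eq_bot, LinearMap.ker_eq_bot']
    intro X hX
    have hX' : X * S = A * X := sub_eq_zero.1 hX
    obtain ⟨a, b, hab⟩ := hcop
    have h1 := mul_aeval_of_intertwining hX' (a * A.charpoly)
    rw [map_mul, map_mul, Matrix.aeval_self_charpoly A, mul_zero, Matrix.zero_mul] at h1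
    have h2 : X = X * Polynomial.aeval S (a * A.charpoly + b * S.charpoly) := by
      rw [hab, map_one, Matrix.mul_one]
    rw [h2, map_add, Matrix.mul_add, map_mul, h1, map_mul, Matrix.aeval_self_charpoly, mul_zero,
      Matrix.mul_zero, add_zero]
  obtain ⟨X, hX⟩ := (LinearMap.injective_iff_surjective.1 hinj) R
  exact ⟨X, by rw [add_comm]; exact sub_eq_iff_eq_add.1 hX⟩

/-- With a single input the controllability matrix is square, so full rank makes its left action
bijective. -/
theorem IsControllable.exists_dual_vector {r : ℕ} {β : Matrix (Fin r) (Fin r) ℝ}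
    {σ : Matrix (Fin r) (Fin 1) ℝ} (h : IsControllable β σ) (a : Fin r → ℝ) :
    ∃ w : Fin r → ℝ, ∀ k : Fin r, (w ᵥ* (β ^ (k : ℕ) * σ)) 0 = a k := by
  let T : (Fin r → ℝ) →ₗ[ℝ] (Fin r → ℝ) :=
    { toFun := fun w k => (w ᵥ* (β ^ (k : ℕ) * σ)) 0
      map_add' := fun w w' => by
        funext k
        simp [Matrix.add_vecMul]
      map_smul' := fun c w => by
        funext k
        simp [Matrix.smul_vecMul] }
  have hinj : Function.Injective T := by
    rw [← LinearMap.ker_eq_bot, LinearMap.ker_eq_bot']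
    intro w hw
    refine eq_zero_of_vecMul_eq_zero (by rw [Fintype.card_fin]; exact h) (w := w) ?_
    funext kj
    obtain ⟨k, j⟩ := kj
    rw [Subsingleton.elim j 0]
    exact congrFun hw k
  obtain ⟨w, hw⟩ := (LinearMap.injective_iff_surjective.1 hinj) a
  exact ⟨w, fun k => congrFun hw k⟩

/-- The internal model property: if `Z S = β Z + σ φ` is solvable for `Z`, then `φ = 0`. -/
theorem IsMinimalInternalModel.eq_zero {q r : ℕ} {S : Matrix (Fin q) (Fin q) ℝ}
    {β : Matrix (Fin r) (Fin r) ℝ} {σ : Matrix (Fin r) (Fin 1) ℝ}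
    (h : IsMinimalInternalModel S β σ) {Z : Matrix (Fin r) (Fin q) ℝ} {φ : Matrix (Fin 1) (Fin q) ℝ}
    (hZ : Z * S = β * Z + σ * φ) : φ = 0 := by
  obtain ⟨w, hw⟩ := h.2.exists_dual_vector fun k => if (k : ℕ) + 1 = r then 1 else 0
  have hdeg : β.charpoly.natDegree = r := by rw [Matrix.charpoly_natDegree_eq_dim, Fintype.card_fin]
  -- Since `w β ^ k σ` is `0` for `k < r - 1` and `1` for `k = r - 1`, `φ` first appears at `k = r`.
  -- The guard `0 < r` excludes the case `r = 0`, where no step is taken.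
  have hpow : ∀ k ≤ r, (w ᵥ* Z) ᵥ* S ^ k =
      (w ᵥ* β ^ k) ᵥ* Z + if k = r ∧ 0 < r then φ 0 else 0 := by
    intro k
    induction k with
    | zero =>
      intro _
      have : ¬(0 = r ∧ 0 < r) := by omega
      simp [this]
    | succ k ih =>
      intro hk
      have hk' : ¬(k = r ∧ 0 < r) := by omega
      have hw' := hw ⟨k, hk⟩
      rw [pow_succ, ← Matrix.vecMul_vecMul, ih (by omega), if_neg hk', add_zero,
        Matrix.vecMul_vecMul, hZ, Matrix.vecMul_add, ← Matrix.vecMul_vecMul,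
        Matrix.vecMul_vecMul w, ← pow_succ]
      congr 1
      rw [← Matrix.vecMul_vecMul, Matrix.vecMul_vecMul w]
      funext j
      rw [Matrix.vecMul, dotProduct, Fin.sum_univ_one, hw']
      by_cases hkr : k + 1 = r
      · have : k + 1 = r ∧ 0 < r := by omega
        simp [this]
      · simp [hkr]
  -- For `r = 0` the minimal polynomial is `1`, so the identity matrix of size `q` is zero.
  rcases Nat.eq_zero_or_pos r with rfl | hr
  · have h1 : Polynomial.aeval S (minpoly ℝ S) = 0 := minpoly.aeval ℝ S
    rw [← h.1, Matrix.charpoly_isEmpty, map_one] at h1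
    rw [← Matrix.mul_one φ, h1, Matrix.mul_zero]
  -- Weight the powers by the coefficients of the monic polynomial `β.charpoly`: it annihilates `β`,
  -- and, being the minimal polynomial, also `S`. Only `φ` remains.
  · have hsum : (w ᵥ* Z) ᵥ* Polynomial.aeval S β.charpoly =
        (w ᵥ* Polynomial.aeval β β.charpoly) ᵥ* Z + φ 0 := by
      rw [Polynomial.aeval_eq_sum_range, Polynomial.aeval_eq_sum_range, hdeg, Matrix.vecMul_sum,
        Matrix.vecMul_sum, Matrix.sum_vecMul]
      have : ∀ k ∈ Finset.range (r + 1), (w ᵥ* Z) ᵥ* (β.charpoly.coeff k • S ^ k) =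
          (w ᵥ* (β.charpoly.coeff k • β ^ k)) ᵥ* Z + if k = r then φ 0 else 0 := by
        intro k hk
        rw [Matrix.vecMul_smul, hpow k (by simpa [Nat.lt_succ_iff] using hk), Matrix.vecMul_smul,
          Matrix.smul_vecMul, smul_add]
        congr 1
        by_cases hkr : k = r
        · have hmonic : β.charpoly.coeff r = 1 := by
            have := β.charpoly_monic.coeff_natDegree
            rwa [hdeg] at this
          simp [hkr, hr, hmonic]
        · simp [hkr]
      rw [Finset.sum_congr rfl this, Finset.sum_add_distrib]
      simp
    rw [Matrix.aeval_self_charpoly, h.1, minpoly.aeval, Matrix.vecMul_zero, Matrix.vecMul_zero,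
      Matrix.zero_vecMul, zero_add] at hsum
    ext i j
    rw [Subsingleton.elim i 0, ← hsum]
    rfl

end InternalModel

/-! ### Coefficients of the resolvent -/

section Resolvent

variable {n : ℕ} (H : Matrix (Fin n) (Fin n) ℝ)

theorem coeff_matPolyEquiv_adjugate (k : ℕ) :
    (matPolyEquiv H.charmatrix.adjugate).coeff k = resolventCoeff H k := by
  ext i j
  rw [matPolyEquiv_coeff_apply]
  rfl

theorem charmatrix_mul_resolvent :
    (Polynomial.X - Polynomial.C H) * matPolyEquiv H.charmatrix.adjugate =
      H.charpoly.map (algebraMap ℝ (Matrix (Fin n) (Fin n) ℝ)) := by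
  rw [← Matrix.matPolyEquiv_charmatrix, ← map_mul, Matrix.mul_adjugate, ← matPolyEquiv_smul_one]
  rfl

/-- The coefficient of `s ^ (k + 1)` in `(s - H) ∑ D_k s ^ k = det (s - H)`. -/
theorem resolventCoeff_succ (k : ℕ) :
    resolventCoeff H k = H * resolventCoeff H (k + 1) + H.charpoly.coeff (k + 1) • 1 := by
  have h := congrArg (fun p => p.coeff (k + 1)) (charmatrix_mul_resolvent H)
  simp only [sub_mul, Polynomial.coeff_sub, Polynomial.coeff_X_mul, Polynomial.coeff_C_mul,
    Polynomial.coeff_map, coeff_matPolyEquiv_adjugate, Algebra.algebraMap_eq_smul_one] at h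
  rw [← h]
  abel

theorem mul_resolventCoeff_zero : H * resolventCoeff H 0 = -(H.charpoly.coeff 0 • 1) := by
  have h := congrArg (fun p => p.coeff 0) (charmatrix_mul_resolvent H)
  simp only [sub_mul, Polynomial.coeff_sub, Polynomial.mul_coeff_zero, Polynomial.coeff_X_zero,
    Polynomial.coeff_C_zero, zero_mul, zero_sub,
    Polynomial.coeff_map, coeff_matPolyEquiv_adjugate, Algebra.algebraMap_eq_smul_one] at h
  rw [← h, neg_neg]

/-- The recursion is run downwards from beyond the degree of the adjugate; above `n` the
characteristic polynomial contributes nothing. -/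
theorem resolventCoeff_eq_zero {k : ℕ} (hk : n ≤ k) : resolventCoeff H k = 0 := by
  have hdown : ∀ d k : ℕ, n ≤ k → resolventCoeff H (k + d) = 0 → resolventCoeff H k = 0 := by
    intro d
    induction d with
    | zero => exact fun k _ h => h
    | succ d ih =>
      intro k hk h
      have h1 : resolventCoeff H (k + 1) = 0 := ih (k + 1) (by omega) (by rwa [add_right_comm])
      have h2 : H.charpoly.coeff (k + 1) = 0 :=
        Polynomial.coeff_eq_zero_of_natDegree_lt
          (by rw [Matrix.charpoly_natDegree_eq_dim, Fintype.card_fin]; omega)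
      rw [resolventCoeff_succ, h1, h2, Matrix.mul_zero, zero_smul, add_zero]
  refine hdown ((matPolyEquiv H.charmatrix.adjugate).natDegree + 1) k hk ?_
  rw [← coeff_matPolyEquiv_adjugate]
  exact Polynomial.coeff_eq_zero_of_natDegree_lt (by omega)

theorem resolventCoeff_pred {k : ℕ} (hk : k + 1 = n) : resolventCoeff H k = 1 := by
  have h2 : H.charpoly.coeff (k + 1) = 1 := by
    have := H.charpoly_monic.coeff_natDegree
    rw [Matrix.charpoly_natDegree_eq_dim, Fintype.card_fin] at this
    rw [hk, this]
  rw [resolventCoeff_succ, resolventCoeff_eq_zero H hk.ge, h2, Matrix.mul_zero, zero_add, one_smul]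

end Resolvent

/-! ### The filter and its intertwiner -/

section Filter

variable {n m p q : ℕ}

/-- Column `j` of the companion matrix has only the `1` in row `j - 1`, absent for `j = 0`, and
`-α_j` in the last row. -/
theorem sum_mul_companion {Λ : ℝ[X]} (f : ℕ → ℝ) (j : Fin n) :
    ∑ k : Fin n, f k * companion n Λ k j =
      (if (j : ℕ) = 0 then 0 else f (j - 1)) - Λ.coeff j * f (n - 1) := by
  have hn := j.2
  have h : ∀ k : Fin n, f k * companion n Λ k j =
      (if (k : ℕ) + 1 = j then f k else 0) - if (k : ℕ) = n - 1 then Λ.coeff j * f k else 0 := by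
    intro k
    have hk := k.2
    rw [companion, Matrix.of_apply]
    by_cases h1 : (k : ℕ) + 1 = j
    · have h2 : (k : ℕ) ≠ n - 1 := by omega
      simp [h1, h2]
    · by_cases h2 : (k : ℕ) + 1 = n
      · have h3 : (k : ℕ) = n - 1 := by omega
        rw [if_neg h1, if_neg h1, if_pos h2, if_pos h3]
        ring
      · have h3 : (k : ℕ) ≠ n - 1 := by omega
        simp [h1, h2, h3]
  rw [Finset.sum_congr rfl fun k _ => h k, Finset.sum_sub_distrib]
  congr 1
  · by_cases hj : (j : ℕ) = 0
    · simp [hj]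
    · rw [if_neg hj, Finset.sum_eq_single ⟨j - 1, by omega⟩]
      · rw [if_pos (by simp only; omega)]
      · intro k _ hk
        rw [if_neg]
        exact fun h => hk (Fin.ext (by simp only; omega))
      · simp
  · rw [Finset.sum_eq_single ⟨n - 1, by omega⟩]
    · simp
    · intro k _ hk
      rw [if_neg]
      exact fun h => hk (Fin.ext h)
    · simp

/-- `M` intertwines the filter matrix with `A - L C`. -/
theorem Plant.M_mul_filterMatrix (P : Plant n m p q) (L : Matrix (Fin n) (Fin p) ℝ) :
    P.M L * filterMatrix n m p (P.A - L * P.C).charpoly = (P.A - L * P.C) * P.M L := by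
  set H := P.A - L * P.C with hH
  ext a ⟨i, j⟩
  set F := Matrix.fromCols P.B L with hF
  have hn := j.2
  have hlhs : (P.M L * filterMatrix n m p H.charpoly) a (i, j) =
      ∑ k : Fin n, (resolventCoeff H k * F) a i * companion n H.charpoly k j := by
    simp only [Matrix.mul_apply (M := P.M L), Fintype.sum_prod_type, filterMatrix,
      Matrix.kroneckerMap_apply, Matrix.one_apply, ite_mul, one_mul, zero_mul, mul_ite, mul_zero]
    rw [Finset.sum_comm]
    simp [Plant.M, ← hH, ← hF]
  have hrhs : (H * P.M L) a (i, j) = (H * (resolventCoeff H j * F)) a i := by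
    simp only [Matrix.mul_apply (M := H)]
    rfl
  rw [hlhs, hrhs, sum_mul_companion fun k => (resolventCoeff H k * F) a i,
    resolventCoeff_pred H (show n - 1 + 1 = n by omega), Matrix.one_mul, ← Matrix.mul_assoc]
  -- With `D_{n-1} = I`, column `j` is `D_{j-1} - α_j I = H D_j`, and column `0` is `-α₀ I = H D₀`,
  -- both applied to a column of `[B, L]`.
  by_cases hj : (j : ℕ) = 0
  · rw [if_pos hj, hj, mul_resolventCoeff_zero]
    simp
  · rw [if_neg hj]
    have h := resolventCoeff_succ H (j - 1)
    rw [show (j : ℕ) - 1 + 1 = j by omega] at h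
    rw [h, Matrix.add_mul]
    simp

theorem Plant.M_mul_lastVec (P : Plant n m p q) (L : Matrix (Fin n) (Fin p) ℝ) (a : Fin n)
    (i : Fin m ⊕ Fin p) :
    ∑ k : Fin n, P.M L a (i, k) * lastVec n k = Matrix.fromCols P.B L a i := by
  have hn : 0 < n := a.pos
  rw [Finset.sum_eq_single ⟨n - 1, by omega⟩]
  · have h : n - 1 + 1 = n := by omega
    simp [Plant.M, lastVec, h, resolventCoeff_pred _ h]
  · intro k _ hk
    have : ¬((k : ℕ) + 1 = n) := fun h => hk (Fin.ext (by simp only; omega))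
    simp [lastVec, this]
  · simp

theorem Plant.M_mul_Bζ (P : Plant n m p q) (L : Matrix (Fin n) (Fin p) ℝ) :
    P.M L * Bζ n m p = P.B := by
  ext a i
  simp only [Matrix.mul_apply, Fintype.sum_prod_type, Bζ, Matrix.of_apply, mul_ite, mul_zero]
  rw [Finset.sum_comm]
  simp [P.M_mul_lastVec L]

theorem Plant.M_mul_Eζ (P : Plant n m p q) (L : Matrix (Fin n) (Fin p) ℝ) :
    P.M L * Eζ n m p = L := by
  ext a i
  simp only [Matrix.mul_apply, Fintype.sum_prod_type, Eζ, Matrix.of_apply, mul_ite, mul_zero]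
  rw [Finset.sum_comm]
  simp [P.M_mul_lastVec L]

/-- The superdiagonal rows force `y_k = μ ^ k y_0`; the last row then reads `Λ(μ) y_0 = 0`. -/
theorem companion_eigen_eq_zero {Λ : ℝ[X]} (hΛ : Λ.Monic) (hdeg : Λ.natDegree = n) {μ : ℂ}
    (hμ : Polynomial.aeval μ Λ ≠ 0) {y : Fin n → ℂ} (hy : toC (companion n Λ) *ᵥ y = μ • y) :
    y = 0 := by
  rcases n with _ | n
  · exact Subsingleton.elim _ _
  have hrow : ∀ i : Fin (n + 1), ∀ hi : (i : ℕ) + 1 < n + 1, y ⟨i + 1, hi⟩ = μ * y i := by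
    intro i hi
    have h := congrFun hy i
    rw [Matrix.mulVec, dotProduct, Finset.sum_eq_single ⟨i + 1, hi⟩] at h
    · simpa [companion] using h
    · intro k _ hk
      have h1 : (i : ℕ) + 1 ≠ k := fun h => hk (Fin.ext h.symm)
      have h2 : (i : ℕ) ≠ n := by omega
      simp [companion, h1, h2]
    · simp
  have hpow : ∀ k : ℕ, ∀ hk : k < n + 1, y ⟨k, hk⟩ = μ ^ k * y 0 := by
    intro k
    induction k with
    | zero => intro hk; simp
    | succ k ih =>
      intro hk
      rw [hrow ⟨k, by omega⟩ hk, ih, pow_succ]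
      ring
  have hlast : -∑ k : Fin (n + 1), (Λ.coeff k : ℂ) * y k = μ * y (Fin.last n) := by
    have h := congrFun hy (Fin.last n)
    rw [Pi.smul_apply, smul_eq_mul] at h
    rw [← h, Matrix.mulVec, dotProduct, ← Finset.sum_neg_distrib]
    refine Finset.sum_congr rfl fun k _ => ?_
    have hk : n + 1 ≠ (k : ℕ) := by omega
    simp [companion, hk]
  have hy0 : y 0 = 0 := by
    have h : Polynomial.aeval μ Λ * y 0 = 0 := by
      rw [Polynomial.aeval_eq_sum_range, hdeg, Finset.sum_range_succ]
      have hl := hΛ.coeff_natDegree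
      rw [hdeg] at hl
      rw [hl, one_smul, ← Fin.sum_univ_eq_sum_range fun k => Λ.coeff k • μ ^ k, add_mul,
        Finset.sum_mul]
      have h1 : ∀ k : Fin (n + 1), Λ.coeff k • μ ^ (k : ℕ) * y 0 = (Λ.coeff k : ℂ) * y k := by
        intro k
        rw [hpow k k.2, Complex.real_smul, mul_assoc]
      rw [Finset.sum_congr rfl fun k _ => h1 k]
      have h2 : y (Fin.last n) = μ ^ n * y 0 := hpow n (by omega)
      linear_combination -hlast - μ * h2
    exact (mul_eq_zero.1 h).resolve_left hμ
  funext k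
  rw [hpow k k.2, hy0, mul_zero, Pi.zero_apply]

theorem isHurwitz_filterMatrix {H : Matrix (Fin n) (Fin n) ℝ} (hH : IsHurwitz H) :
    IsHurwitz (filterMatrix n m p H.charpoly) := by
  rw [isHurwitz_iff_mulVec]
  intro μ hμ x hx
  funext ⟨i, j⟩
  have hne : Polynomial.aeval μ H.charpoly ≠ 0 := fun h =>
    (hH μ ((mem_spectrum_iff_aeval_charpoly H μ).2 h)).not_ge hμ
  refine congrFun (companion_eigen_eq_zero (y := fun j => x (i, j)) H.charpoly_monic
    (by rw [Matrix.charpoly_natDegree_eq_dim, Fintype.card_fin]) hne ?_) j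
  funext k
  have h := congrFun hx (i, k)
  rw [Pi.smul_apply] at h
  rw [Pi.smul_apply, ← h]
  simp only [Matrix.mulVec, dotProduct, Fintype.sum_prod_type]
  rw [Finset.sum_eq_single i]
  · simp [filterMatrix]
  · intro i' _ hi'
    simp [filterMatrix, Matrix.one_apply_ne hi'.symm]
  · simp

end Filter

/-! ### From a Hurwitz closed loop to output regulation -/

section ClosedLoop

variable {n m p q r : ℕ} {ι : Type} [Fintype ι]

/-- The system matrix of plant and law in closed loop, with state `col (x, ξ)`. -/
def closedLoopMatrix (P : Plant n m p q) (Γ : OutputFeedbackLaw m p ι) :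
    Matrix (Fin n ⊕ ι) (Fin n ⊕ ι) ℝ :=
  Matrix.fromBlocks P.A (P.B * Γ.K) ((Γ.Ny + Γ.Ne) * P.C) (Γ.N + Γ.Nu * Γ.K)

/-- The matrix through which the exogenous signal enters the closed loop. -/
def closedLoopInput (P : Plant n m p q) (Γ : OutputFeedbackLaw m p ι) :
    Matrix (Fin n ⊕ ι) (Fin q) ℝ :=
  Matrix.fromRows P.E (Γ.Ne * P.F)

theorem IsClosedLoopTrajectory.hasDerivWithinAt {P : Plant n m p q} {Γ : OutputFeedbackLaw m p ι}
    {v : ℝ → Fin q → ℝ} {x : ℝ → Fin n → ℝ} {ξ : ℝ → ι → ℝ}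
    (h : IsClosedLoopTrajectory P Γ v x ξ) (t : ℝ) (ht : 0 ≤ t) :
    HasDerivWithinAt (fun t => Sum.elim (x t) (ξ t))
      (closedLoopMatrix P Γ *ᵥ Sum.elim (x t) (ξ t) + closedLoopInput P Γ *ᵥ v t) (Set.Ici 0) t := by
  have hx := hasDerivWithinAt_pi.1 (h.plant t ht)
  have hξ := hasDerivWithinAt_pi.1 (h.law t ht)
  rw [hasDerivWithinAt_pi]
  rintro (i | i)
  · refine (hx i).congr_deriv ?_
    simp [closedLoopMatrix, closedLoopInput, Matrix.fromBlocks_mulVec, Matrix.mulVec_mulVec]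
  · refine (hξ i).congr_deriv ?_
    simp only [closedLoopMatrix, closedLoopInput, Matrix.fromBlocks_mulVec, Matrix.fromRows_mulVec,
      Pi.add_apply, Sum.elim_inr, Sum.elim_comp_inl, Sum.elim_comp_inr, Matrix.add_mulVec,
      Matrix.add_mul, Matrix.mulVec_add, Matrix.mulVec_mulVec]
    ring

theorem norm_sumElim (x : Fin n → ℝ) (ξ : ι → ℝ) : ‖Sum.elim x ξ‖ = ‖(x, ξ)‖ := by
  refine le_antisymm ?_ ?_
  · rw [pi_norm_le_iff_of_nonneg (norm_nonneg _)]
    rintro (i | i)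
    · exact (norm_le_pi_norm x i).trans (norm_fst_le (x, ξ))
    · exact (norm_le_pi_norm ξ i).trans (norm_snd_le (x, ξ))
  · rw [norm_prod_le_iff, pi_norm_le_iff_of_nonneg (norm_nonneg _),
      pi_norm_le_iff_of_nonneg (norm_nonneg _)]
    exact ⟨fun i => norm_le_pi_norm (Sum.elim x ξ) (Sum.inl i),
      fun i => norm_le_pi_norm (Sum.elim x ξ) (Sum.inr i)⟩

/-- A law solves the output regulation problem if the closed loop is Hurwitz and every solution of
the Sylvester equation of the closed loop zeroes the regulated output. -/
theorem solvesOutputRegulation_of_isHurwitz [DecidableEq ι] {P : Plant n m p q}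
    {Γ : OutputFeedbackLaw m p ι}
    (hS : ∀ μ ∈ spectrum ℂ (toC P.S), 0 ≤ μ.re) (hH : IsHurwitz (closedLoopMatrix P Γ))
    (hreg : ∀ X : Matrix (Fin n ⊕ ι) (Fin q) ℝ,
      X * P.S = closedLoopMatrix P Γ * X + closedLoopInput P Γ →
        P.C * X.submatrix Sum.inl id + P.F = 0) :
    SolvesOutputRegulation P Γ := by
  obtain ⟨k, hk, c, hc, hdecay⟩ := hH.exists_decay
  refine ⟨⟨k, hk, c, hc, fun x ξ h t ht => ?_⟩, fun v x ξ h => ?_⟩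
  · rw [← norm_sumElim, ← norm_sumElim]
    refine hdecay (fun t => Sum.elim (x t) (ξ t)) (fun t ht => ?_) t ht
    simpa using h.hasDerivWithinAt t ht
  · obtain ⟨X, hX⟩ := exists_sylvester_solution hH hS (closedLoopInput P Γ)
    -- The deviation from the steady state `X v`; by the Sylvester equation it obeys the unforced
    -- closed loop.
    set W : ℝ → Fin n ⊕ ι → ℝ := fun t => Sum.elim (x t) (ξ t) - X *ᵥ v t with hW
    have hW' : ∀ t, 0 ≤ t → HasDerivWithinAt W (closedLoopMatrix P Γ *ᵥ W t) (Set.Ici 0) t := by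
      intro t ht
      refine ((h.hasDerivWithinAt t ht).sub
        (hasDerivWithinAt_mulVec X (h.exosystem t ht))).congr_deriv ?_
      rw [Matrix.mulVec_mulVec, hX, hW, Matrix.mulVec_sub, Matrix.add_mulVec, Matrix.mulVec_mulVec]
      abel
    have hW0 : Filter.Tendsto W Filter.atTop (nhds 0) := by
      rw [tendsto_zero_iff_norm_tendsto_zero]
      have hexp : Filter.Tendsto (fun t : ℝ => k * Real.exp (-c * t) * ‖W 0‖) Filter.atTop
          (nhds 0) := by
        have h1 : Filter.Tendsto (fun t : ℝ => -c * t) Filter.atTop Filter.atBot :=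
          Filter.tendsto_id.const_mul_atTop_of_neg (by linarith)
        simpa using ((Real.tendsto_exp_atBot.comp h1).const_mul k).mul_const ‖W 0‖
      refine squeeze_zero' (Filter.Eventually.of_forall fun t => norm_nonneg _) ?_ hexp
      filter_upwards [Filter.eventually_ge_atTop (0 : ℝ)] with t ht
      exact hdecay W hW' t ht
    have he : (fun t => P.C *ᵥ x t + P.F *ᵥ v t) = fun t => P.C *ᵥ (W t ∘ Sum.inl) := by
      funext t
      have h1 : W t ∘ Sum.inl = x t - X.submatrix Sum.inl id *ᵥ v t := by
        funext i
        simp [hW, Matrix.mulVec, dotProduct]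
      have h2 := congrArg (fun Q => Q *ᵥ v t) (hreg X hX)
      rw [Matrix.zero_mulVec, Matrix.add_mulVec, ← Matrix.mulVec_mulVec] at h2
      rw [h1, Matrix.mulVec_sub, eq_sub_iff_add_eq, add_assoc, add_comm (P.F *ᵥ v t), h2, add_zero]
    rw [he]
    have hcont : Continuous fun w : Fin n ⊕ ι → ℝ => P.C *ᵥ (w ∘ Sum.inl) :=
      Continuous.matrix_mulVec continuous_const (by fun_prop)
    have h0 : P.C *ᵥ ((0 : Fin n ⊕ ι → ℝ) ∘ Sum.inl) = 0 := by simp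
    rw [← h0]
    exact (hcont.tendsto 0).comp hW0

end ClosedLoop

/-! ### The closed loop with the regulator -/

section Regulator

variable {n m p q r : ℕ}

/-- The output injection `col (E_ζ, G₂)` of the regulator. -/
def outputInjection (n m : ℕ) (p : ℕ) {r : ℕ} (σ : Matrix (Fin r) (Fin 1) ℝ) :
    Matrix (RhoIndex n m p r) (Fin p) ℝ :=
  Matrix.fromRows (Eζ n m p) (G₂ p σ)

/-- The matrix `[M, 0]` acting on `ρ = col (ζ, z)`. -/
def Plant.Mρ (P : Plant n m p q) (L : Matrix (Fin n) (Fin p) ℝ) (r : ℕ) :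
    Matrix (Fin n) (RhoIndex n m p r) ℝ :=
  Matrix.fromCols (P.M L) 0

theorem Plant.Mρ_mul_outputInjection (P : Plant n m p q) (L : Matrix (Fin n) (Fin p) ℝ)
    (σ : Matrix (Fin r) (Fin 1) ℝ) : P.Mρ L r * outputInjection n m p σ = L := by
  rw [Plant.Mρ, outputInjection, Matrix.fromCols_mul_fromRows, Matrix.zero_mul, add_zero,
    P.M_mul_Eζ]

theorem Plant.Mρ_mul_Bρ (P : Plant n m p q) (L : Matrix (Fin n) (Fin p) ℝ) :
    P.Mρ L r * Bρ n m p r = P.B := by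
  rw [Plant.Mρ, Bρ, Matrix.fromCols_mul_fromRows, Matrix.zero_mul, add_zero, P.M_mul_Bζ]

theorem Plant.Mρ_mul_blockdiag (P : Plant n m p q) (L : Matrix (Fin n) (Fin p) ℝ)
    (β : Matrix (Fin r) (Fin r) ℝ) :
    P.Mρ L r * Matrix.fromBlocks (filterMatrix n m p (P.A - L * P.C).charpoly) 0 0 (G₁ p β) =
      (P.A - L * P.C) * P.Mρ L r := by
  rw [Plant.Mρ, Matrix.fromCols_mul_fromBlocks, P.M_mul_filterMatrix, Matrix.mul_fromCols]
  simp

/-- `A_ρ` is the regulator dynamics in which the plant state is replaced by its estimate `M ζ`. -/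
theorem Plant.Aρ_eq (P : Plant n m p q) (L : Matrix (Fin n) (Fin p) ℝ)
    (β : Matrix (Fin r) (Fin r) ℝ) (σ : Matrix (Fin r) (Fin 1) ℝ) :
    P.Aρ L β σ =
      Matrix.fromBlocks (filterMatrix n m p (P.A - L * P.C).charpoly) 0 0 (G₁ p β) +
        outputInjection n m p σ * P.C * P.Mρ L r := by
  rw [Plant.Aρ, Plant.Aζ, outputInjection, Plant.Mρ, Matrix.fromRows_mul,
    Matrix.fromRows_mul_fromCols, Matrix.fromBlocks_add]
  simp

/-- In the coordinates `(x - M ζ, ζ, z)` the closed loop is block triangular. -/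
theorem isHurwitz_closedLoopMatrix_regulator {P : Plant n m p q} {L : Matrix (Fin n) (Fin p) ℝ}
    (hL : IsHurwitz (P.A - L * P.C)) {β : Matrix (Fin r) (Fin r) ℝ} {σ : Matrix (Fin r) (Fin 1) ℝ}
    {Kρ : Matrix (Fin m) (RhoIndex n m p r) ℝ}
    (hK : IsHurwitz (P.Aρ L β σ + Bρ n m p r * Kρ)) :
    IsHurwitz (closedLoopMatrix P (regulator (P.A - L * P.C).charpoly β σ Kρ)) := by
  set H := P.A - L * P.C with hH
  set N : Matrix (RhoIndex n m p r) (RhoIndex n m p r) ℝ :=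
    Matrix.fromBlocks (filterMatrix n m p H.charpoly) 0 0 (G₁ p β) with hN
  set G := outputInjection n m p σ with hG
  have hcl : closedLoopMatrix P (regulator H.charpoly β σ Kρ) =
      Matrix.fromBlocks P.A (P.B * Kρ) (G * P.C) (N + Bρ n m p r * Kρ) := by
    have hNy : (regulator H.charpoly β σ Kρ : OutputFeedbackLaw m p _).Ny +
        (regulator H.charpoly β σ Kρ : OutputFeedbackLaw m p _).Ne = G := by
      rw [hG]
      ext (i | i) j <;> simp [regulator, outputInjection]
    rw [closedLoopMatrix, hNy]
    rfl
  have h1 : P.Mρ L r * N = H * P.Mρ L r := P.Mρ_mul_blockdiag L β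
  have h2 : P.Mρ L r * G = L := P.Mρ_mul_outputInjection L σ
  have h3 : P.Mρ L r * Bρ n m p r = P.B := P.Mρ_mul_Bρ L
  rw [hcl]
  -- The change of coordinates `(x, ρ) ↦ (x - M ζ, ρ)` and its inverse.
  refine (hL.fromBlocks_zero₁₂ hK (G * P.C)).of_intertwining
    (Matrix.fromBlocks 1 (-P.Mρ L r) 0 1) (Matrix.fromBlocks 1 (P.Mρ L r) 0 1) ?_ ?_
  · rw [Matrix.fromBlocks_multiply]
    simp
  · rw [Matrix.fromBlocks_multiply, Matrix.fromBlocks_multiply, P.Aρ_eq]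
    simp only [Matrix.one_mul, Matrix.mul_one, Matrix.zero_mul, Matrix.mul_zero, zero_add, add_zero,
      Matrix.neg_mul, Matrix.mul_neg, Matrix.mul_add, ← Matrix.mul_assoc, h1, h2, h3]
    congr 1
    · rw [hH]
      abel
    · abel

/-- The `z` rows of the Sylvester equation decouple into `p` copies of `Z S = β Z + σ φ`, one for
each component of the regulated output. -/
theorem isMinimalInternalModel_zeroes_output {P : Plant n m p q} {Λ : ℝ[X]}
    {β : Matrix (Fin r) (Fin r) ℝ} {σ : Matrix (Fin r) (Fin 1) ℝ}
    (h : IsMinimalInternalModel P.S β σ) {Kρ : Matrix (Fin m) (RhoIndex n m p r) ℝ}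
    {X : Matrix (Fin n ⊕ RhoIndex n m p r) (Fin q) ℝ}
    (hX : X * P.S = closedLoopMatrix P (regulator Λ β σ Kρ) * X +
      closedLoopInput P (regulator Λ β σ Kρ)) :
    P.C * X.submatrix Sum.inl id + P.F = 0 := by
  set φ := P.C * X.submatrix Sum.inl id + P.F with hφ
  ext i j
  have key : φ.submatrix (fun _ : Fin 1 => i) id = 0 := by
    refine h.eq_zero (Z := X.submatrix (fun k => Sum.inr (Sum.inr (i, k))) id) ?_
    ext k j
    have h1 := congrFun (congrFun hX (Sum.inr (Sum.inr (i, k)))) j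
    have h2 : (X.submatrix (fun k => Sum.inr (Sum.inr (i, k))) id * P.S) k j =
        (X * P.S) (Sum.inr (Sum.inr (i, k))) j := rfl
    rw [h2, h1]
    have h3 : ((G₂ p σ) * φ) (i, k) j = (σ * φ.submatrix (fun _ : Fin 1 => i) id) k j := by
      simp [Matrix.mul_apply, G₂]
    have h4 : (G₁ p β * X.submatrix (fun k => Sum.inr (Sum.inr k)) id) (i, k) j =
        (β * X.submatrix (fun k => Sum.inr (Sum.inr (i, k))) id) k j := by
      simp only [Matrix.mul_apply, Fintype.sum_prod_type]
      rw [Finset.sum_eq_single i]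
      · simp [G₁]
      · intro i' _ hi'
        simp [G₁, Matrix.one_apply_ne hi'.symm]
      · simp
    rw [Matrix.add_apply, Matrix.add_apply, ← h3, ← h4, hφ, Matrix.mul_add, Matrix.add_apply,
      ← Matrix.mul_assoc]
    simp only [Matrix.mul_apply (M := closedLoopMatrix _ _), Fintype.sum_sum_type]
    have h5 : ∀ x, ((Matrix.fromRows (Eζ n m p) 0 + Matrix.fromRows 0 (G₂ p σ) :
        Matrix (RhoIndex n m p r) (Fin p) ℝ) * P.C : Matrix (RhoIndex n m p r) (Fin n) ℝ)
        (Sum.inr (i, k)) x = (G₂ p σ * P.C) (i, k) x := fun x => by simp [Matrix.mul_apply]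
    simp only [closedLoopMatrix, closedLoopInput, regulator, Matrix.fromRows_mul,
      Matrix.fromBlocks_apply₂₁, Matrix.fromBlocks_apply₂₂, Matrix.fromRows_apply_inr, h5,
      Matrix.add_apply, Matrix.zero_mul, Matrix.zero_apply, zero_mul, add_zero,
      Finset.sum_const_zero, zero_add]
    rw [add_comm (∑ x, _), add_assoc]
    rfl
  exact congrFun (congrFun key 0) j

end Regulator

/-! ### Stabilizability of the augmented system -/

section AugmentedSystem

variable {n m p q r : ℕ}

/-- Observability of `(A, C)` yields an output injection making `A - L C` Hurwitz. -/
theorem IsObservable.exists_isHurwitz {A : Matrix (Fin n) (Fin n) ℝ} {C : Matrix (Fin p) (Fin n) ℝ}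
    (h : IsObservable A C) : ∃ L : Matrix (Fin n) (Fin p) ℝ, IsHurwitz (A - L * C) := by
  have hH : HautusStabilizable Aᵀ Cᵀ := fun μ _ w hw hC => h.eigen_eq_zero (μ := μ)
    (by rw [← hw, ← toC_transpose, Matrix.vecMul_transpose])
    (by rw [← hC, ← toC_transpose, Matrix.vecMul_transpose])
  obtain ⟨K, hK⟩ := hH.isStabilizable
  refine ⟨-Kᵀ, ?_⟩
  have := hK.transpose
  rwa [Matrix.transpose_add, Matrix.transpose_transpose, Matrix.transpose_mul,
    Matrix.transpose_transpose, ← sub_neg_eq_add, ← Matrix.neg_mul] at this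

theorem G₁_eigen_apply {β : Matrix (Fin r) (Fin r) ℝ} {μ : ℂ} {η : Fin p × Fin r → ℂ}
    (h : η ᵥ* toC (G₁ p β) = μ • η) (i : Fin p) :
    (fun k => η (i, k)) ᵥ* toC β = μ • fun k => η (i, k) := by
  funext k
  have h1 := congrFun h (i, k)
  rw [Pi.smul_apply] at h1
  rw [Pi.smul_apply, ← h1]
  simp only [Matrix.vecMul, dotProduct, Fintype.sum_prod_type]
  symm
  rw [Finset.sum_eq_single i]
  · simp [G₁]
  · intro i' _ hi'
    simp [G₁, Matrix.one_apply_ne hi']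
  · simp

theorem vecMul_G₂_apply (σ : Matrix (Fin r) (Fin 1) ℝ) (η : Fin p × Fin r → ℂ) (i : Fin p) :
    (η ᵥ* toC (G₂ p σ)) i = ((fun k => η (i, k)) ᵥ* toC σ) 0 := by
  simp only [Matrix.vecMul, dotProduct, Fintype.sum_prod_type]
  rw [Finset.sum_eq_single i]
  · simp [G₂]
  · intro i' _ hi'
    simp [G₂, hi']
  · simp

/-- The augmented auxiliary system satisfies the Hautus condition. -/
theorem Plant.StandingAssumptions.hautusStabilizable {P : Plant n m p q}
    (hP : P.StandingAssumptions) {β : Matrix (Fin r) (Fin r) ℝ} {σ : Matrix (Fin r) (Fin 1) ℝ}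
    (hβ : IsMinimalInternalModel P.S β σ) {L : Matrix (Fin n) (Fin p) ℝ}
    (hL : IsHurwitz (P.A - L * P.C)) :
    HautusStabilizable (P.Aρ L β σ) (Bρ n m p r) := by
  intro μ hμ x hA hB
  set H := P.A - L * P.C with hH
  set w : (Fin m ⊕ Fin p) × Fin n → ℂ := x ∘ Sum.inl with hw
  set η : Fin p × Fin r → ℂ := x ∘ Sum.inr with hη
  set g : Fin p → ℂ := w ᵥ* toC (Eζ n m p) + η ᵥ* toC (G₂ p σ) with hg
  have hblocks := hA
  rw [Plant.Aρ, toC, Matrix.fromBlocks_map, Matrix.vecMul_fromBlocks] at hblocks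
  have hη1 : η ᵥ* toC (G₁ p β) = μ • η := by
    funext i
    have := congrFun hblocks (Sum.inr i)
    simpa [toC, hw, hη] using this
  have hw1 : w ᵥ* toC (filterMatrix n m p H.charpoly) + (g ᵥ* toC P.C) ᵥ* toC (P.M L) = μ • w := by
    have h1 : w ᵥ* toC (P.Aζ L) + η ᵥ* toC (G₂ p σ * P.C * P.M L) = μ • w := by
      funext i
      have := congrFun hblocks (Sum.inl i)
      simpa [toC, hw, hη] using this
    rw [← h1, Plant.Aζ, toC_add, toC_mul, toC_mul, toC_mul, toC_mul, Matrix.vecMul_add, hg,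
      Matrix.add_vecMul, Matrix.add_vecMul]
    simp only [Matrix.vecMul_vecMul, Matrix.mul_assoc, add_assoc]
    rfl
  have hwB : w ᵥ* toC (Bζ n m p) = 0 := by
    have h1 : toC (Bρ n m p r) = Matrix.fromRows (toC (Bζ n m p)) 0 := by
      ext (i | i) j <;> simp [Bρ]
    rw [h1, ← Sum.elim_comp_inl_inr x, Matrix.sumElim_vecMul_fromRows, Matrix.vecMul_zero,
      add_zero] at hB
    exact hB
  have hres : IsUnit (algebraMap ℂ (Matrix (Fin n) (Fin n) ℂ) μ - toC H) := by
    by_contra hcon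
    exact (hL μ (spectrum.mem_iff.2 hcon)).not_ge hμ
  -- Chosen so that `h M` satisfies the same equation `w (I ⊗ 𝒜) + g C M = μ w` as `w`. The
  -- difference is a left eigenvector of the Hurwitz filter matrix for `μ` unless it vanishes,
  -- whence `w = h M`.
  set h : Fin n → ℂ :=
    (g ᵥ* toC P.C) ᵥ* (algebraMap ℂ (Matrix (Fin n) (Fin n) ℂ) μ - toC H)⁻¹ with hh
  have hhH : h ᵥ* toC H = μ • h - g ᵥ* toC P.C := by
    have h1 : h ᵥ* (algebraMap ℂ (Matrix (Fin n) (Fin n) ℂ) μ - toC H) = g ᵥ* toC P.C := by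
      rw [hh, Matrix.vecMul_vecMul,
        Matrix.nonsing_inv_mul _ ((Matrix.isUnit_iff_isUnit_det _).1 hres), Matrix.vecMul_one]
    rw [Matrix.vecMul_sub, Algebra.algebraMap_eq_smul_one, Matrix.vecMul_smul,
      Matrix.vecMul_one] at h1
    rw [← h1]
    abel
  have hwM : w = h ᵥ* toC (P.M L) := by
    rw [← sub_eq_zero]
    refine (isHurwitz_iff_vecMul _).1 (isHurwitz_filterMatrix (m := m) (p := p) hL) μ hμ _ ?_
    rw [Matrix.sub_vecMul, Matrix.vecMul_vecMul, ← toC_mul, P.M_mul_filterMatrix, toC_mul,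
      ← Matrix.vecMul_vecMul, hhH, Matrix.sub_vecMul, Matrix.smul_vecMul, smul_sub, ← hw1]
    abel
  have hhB : h ᵥ* toC P.B = 0 := by
    rw [← P.M_mul_Bζ L, toC_mul, ← Matrix.vecMul_vecMul, ← hwM, hwB]
  have hhA : h ᵥ* toC P.A + (η ᵥ* toC (G₂ p σ)) ᵥ* toC P.C = μ • h := by
    have h1 : w ᵥ* toC (Eζ n m p) = h ᵥ* toC L := by
      rw [hwM, Matrix.vecMul_vecMul, ← toC_mul, P.M_mul_Eζ]
    rw [hH, toC_sub, toC_mul, Matrix.vecMul_sub, hg, h1, Matrix.add_vecMul,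
      ← Matrix.vecMul_vecMul, sub_eq_iff_eq_add] at hhH
    rw [hhH]
    abel
  have hhη : h = 0 ∧ η = 0 := by
    -- On the spectrum of `S` the row `(h, η G₂)` annihilates the transmission matrix; off it, `μ`
    -- is not an eigenvalue of `β`.
    by_cases hμS : μ ∈ spectrum ℂ (toC P.S)
    · have hz : Sum.elim h (η ᵥ* toC (G₂ p σ)) = 0 := by
        refine eq_zero_of_vecMul_eq_zero
          (by rw [Fintype.card_sum, Fintype.card_fin, Fintype.card_fin]
              exact hP.transmission μ hμS) ?_
        rw [Matrix.vecMul_fromBlocks, Sum.elim_comp_inl, Sum.elim_comp_inr, Matrix.vecMul_sub,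
          Matrix.vecMul_smul, Matrix.vecMul_one, Matrix.vecMul_zero, add_zero, hhB,
          sub_add_eq_add_sub, hhA, sub_self]
        exact Sum.elim_zero_zero
      refine ⟨funext fun i => congrFun hz (Sum.inl i), ?_⟩
      funext ⟨i, k⟩
      refine congrFun (hβ.2.eigen_eq_zero (G₁_eigen_apply hη1 i) ?_) k
      funext j
      rw [Subsingleton.elim j 0, ← vecMul_G₂_apply]
      exact congrFun hz (Sum.inr i)
    · have hη0 : η = 0 := by
        funext ⟨i, k⟩
        by_contra hne
        refine hμS (mem_spectrum_of_aeval_minpoly ?_)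
        rw [← hβ.1, ← mem_spectrum_iff_aeval_charpoly, mem_spectrum_iff_vecMul]
        exact ⟨_, fun h0 => hne (congrFun h0 k), G₁_eigen_apply hη1 i⟩
      rw [hη0, Matrix.zero_vecMul, Matrix.zero_vecMul, add_zero] at hhA
      exact ⟨hP.stabilizable.hautus μ hμ h hhA hhB, hη0⟩
  rw [hhη.1, Matrix.zero_vecMul] at hwM
  rw [← Sum.elim_comp_inl_inr x, ← hw, ← hη, hwM, hhη.2]
  exact Sum.elim_zero_zero

end AugmentedSystem

end

end OutputRegulation

theorem theorem3 {n m p q r : ℕ}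
    (β : Matrix (Fin r) (Fin r) ℝ) (σ : Matrix (Fin r) (Fin 1) ℝ) :
    (∀ P : Plant n m p q, P.StandingAssumptions → IsMinimalInternalModel P.S β σ →
      (∃ L : Matrix (Fin n) (Fin p) ℝ, IsHurwitz (P.A - L * P.C)) ∧
      ∀ L : Matrix (Fin n) (Fin p) ℝ, IsHurwitz (P.A - L * P.C) →
        IsStabilizable (P.Aρ L β σ) (Bρ n m p r)) ∧
    (∀ (Λ : ℝ[X]) (Kρ : Matrix (Fin m) (RhoIndex n m p r) ℝ),
      SolvesModelFreeOutputRegulation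
        {P : Plant n m p q | P.StandingAssumptions ∧ IsMinimalInternalModel P.S β σ ∧
          ∃ L : Matrix (Fin n) (Fin p) ℝ, IsHurwitz (P.A - L * P.C) ∧
            (P.A - L * P.C).charpoly = Λ ∧ IsHurwitz (P.Aρ L β σ + Bρ n m p r * Kρ)}
        (regulator Λ β σ Kρ)) := by
  refine ⟨fun P hP hβ => ⟨hP.observable.exists_isHurwitz, fun L hL =>
    (hP.hautusStabilizable hβ hL).isStabilizable⟩, ?_⟩
  rintro Λ Kρ P ⟨hP, hβ, L, hL, rfl, hK⟩
  exact solvesOutputRegulation_of_isHurwitz hP.exosystem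
    (isHurwitz_closedLoopMatrix_regulator hL hK)
    fun X hX => isMinimalInternalModel_zeroes_output hβ hX
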